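/- Let $n\ge 0$ be an integer and let $\Omega=\mathbb{C}[x_1,\dots,x_n]\otimes\bigwedge\mathbb{C}^n$ be the algebra of differential forms on $\mathbb{C}^n$ with polynomial coefficients, where $\bigwedge\mathbb{C}^n$ is the exterior algebra on $dx_1,\dots,dx_n$ and the two tensor factors commute. For $l,k\ge 0$ let $\Omega^{l,k}$ be the space of all forms $$\sum_{1\le i_1<\cdots<i_k\le n} f_{i_1\dots i_k}\,dx_{i_1}\wedge\cdots\wedge dx_{i_k}$$ whose coefficients $f_{i_1\dots i_k}\in\mathbb{C}[x_1,\dots,x_n]$ are homogeneous of degree $l$ (or zero). Let $p_j=\sum_{i=1}^n x_i^j$, let $dp_j=\sum_{i=1}^n \frac{\partial p_j}{\partial x_i}\,dx_i$, and let $\mathcal{I}$ be the two-sided ideal of $\Omega$ generated by $p_1,\dots,p_n,dp_1,\dots,dp_n$. For $j\ge 1$ let $d_j:\Omega\to\Omega$ be the linear operator with $$d_j\bigl(f\,dx_{i_1}\wedge\cdots\wedge dx_{i_k}\bigr)=\sum_{m=1}^n \frac{\partial^j f}{\partial x_m^j}\,dx_m\wedge dx_{i_1}\wedge\cdots\wedge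 dx_{i_k},$$ and let $\Delta=\prod_{1\le i<j\le n}(x_i-x_j)$. (1) If $k,l\ge 0$, $l>\binom{n}{2}-\binom{k+1}{2}$ and $\omega\in\Omega^{l,k}$, then $\omega\in\mathcal{I}$. (2) This bound is sharp. Let $k\ge 0$ be such that $l=\binom{n}{2}-\binom{k+1}{2}\ge 0$ (for $n\ge 1$ this means $0\le k\le n-1$). Then the image of $\Omega^{l,k}$ in $\Omega/\mathcal{I}$ is nonzero. More precisely, $d_1d_2\cdots d_k\Delta$ (which is $\Delta$ if $k=0$) lies in $\Omega^{l,k}$ and its image in $\Omega/\mathcal{I}$ is nonzero. -/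

import Mathlib

open scoped TensorProduct

noncomputable section

namespace PolyForms

/-- The polynomial ring `ℂ[x_1, …, x_n]`. -/
abbrev Poly (n : ℕ) : Type := MvPolynomial (Fin n) ℂ

/-- The Grassmann algebra `⋀ ℂⁿ`. -/
abbrev Grass (n : ℕ) : Type := ExteriorAlgebra ℂ (Fin n → ℂ)

/-- The algebra `Ω_n = ℂ[x_1, …, x_n] ⊗ ⋀ ℂⁿ` of differential forms on `ℂⁿ` with polynomial
coefficients; the two tensor factors commute with each other. -/
abbrev Omega (n : ℕ) : Type := Poly n ⊗[ℂ] Grass n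

/-- The generator `dx_i` of the Grassmann algebra. -/
def dx {n : ℕ} (i : Fin n) : Grass n :=
  ExteriorAlgebra.ι ℂ (Pi.single i (1 : ℂ))

/-- `dx_{i_1} ∧ ⋯ ∧ dx_{i_k}` for `i_1 < ⋯ < i_k`. -/
def dxWedge {n k : ℕ} (I : Fin k ↪o Fin n) : Grass n :=
  (List.ofFn fun r : Fin k => dx (I r)).prod

/-- The space `Ω^{l,k}` of the `k`-forms `∑_{i_1 < ⋯ < i_k} f_{i_1 … i_k} dx_{i_1} ∧ ⋯ ∧ dx_{i_k}`
with every coefficient `f_{i_1 … i_k}` a homogeneous polynomial of degree `l` (or zero). -/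
def homForms (n l k : ℕ) : Submodule ℂ (Omega n) where
  carrier := {ω | ∃ f : (Fin k ↪o Fin n) → Poly n,
    (∀ I, (f I).IsHomogeneous l) ∧ ω = ∑ I, f I ⊗ₜ[ℂ] dxWedge I}
  zero_mem' := ⟨fun _ => 0, fun _ => MvPolynomial.isHomogeneous_zero _ _ _, by simp⟩
  add_mem' := by
    rintro _ _ ⟨f, hf, rfl⟩ ⟨g, hg, rfl⟩
    exact ⟨fun I => f I + g I, fun I => (hf I).add (hg I), by
      simp [TensorProduct.add_tmul, Finset.sum_add_distrib]⟩
  smul_mem' := by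
    rintro c _ ⟨f, hf, rfl⟩
    exact ⟨fun I => c • f I,
      fun I => (MvPolynomial.homogeneousSubmodule (Fin n) ℂ l).smul_mem c (hf I), by
      simp [TensorProduct.smul_tmul', Finset.smul_sum]⟩

/-- The partial derivative `∂ / ∂x_i` of polynomials, as a linear operator. -/
def partialD {n : ℕ} (i : Fin n) : Module.End ℂ (Poly n) :=
  (MvPolynomial.pderiv i).toLinearMap

/-- The operator `d_j`:
`d_j (f dx_I) = ∑_i (∂_i ^ j f) dx_i ∧ dx_I`; in particular `d_1` is the exterior derivative. -/
def dOp (n j : ℕ) : Module.End ℂ (Omega n) :=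
  ∑ i : Fin n, TensorProduct.map (partialD i ^ j) (LinearMap.mulLeft ℂ (dx i))

/-- The power sum `p_j = x_1 ^ j + ⋯ + x_n ^ j` as a `0`-form. -/
def powerSum (n j : ℕ) : Omega n :=
  MvPolynomial.psum (Fin n) ℂ j ⊗ₜ[ℂ] (1 : Grass n)

/-- The differential `dp_j = ∑_i (∂p_j / ∂x_i) dx_i` of the power sum `p_j`. -/
def dPowerSum (n j : ℕ) : Omega n :=
  ∑ i : Fin n, partialD i (MvPolynomial.psum (Fin n) ℂ j) ⊗ₜ[ℂ] dx i

/-- The (two-sided) ideal of `Ω_n` generated by `p_1, …, p_n, dp_1, …, dp_n`. -/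
def invIdeal (n : ℕ) : TwoSidedIdeal (Omega n) :=
  TwoSidedIdeal.span (powerSum n '' Set.Icc 1 n ∪ dPowerSum n '' Set.Icc 1 n)

/-- The quotient algebra `Ω_n / ℐ`. -/
abbrev OmegaQuot (n : ℕ) : Type := (invIdeal n).ringCon.Quotient

/-- The quotient map `Ω_n → Ω_n / ℐ`, a homomorphism of `ℂ`-algebras. -/
def toQuot (n : ℕ) : Omega n →ₐ[ℂ] OmegaQuot n := RingCon.mkₐ ℂ (invIdeal n).ringCon

/-- The Vandermonde polynomial `Δ = ∏_{i < j} (x_i - x_j)`, as a `0`-form. -/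
def vandermonde (n : ℕ) : Omega n :=
  (∏ i : Fin n, ∏ j ∈ Finset.Ioi i, (MvPolynomial.X i - MvPolynomial.X j : Poly n)) ⊗ₜ[ℂ]
    (1 : Grass n)

/-- The form `d_1 d_2 ⋯ d_k Δ` (the operators are composed, and `d_k` acts first). -/
def dVandermonde (n k : ℕ) : Omega n :=
  ((List.range k).map fun r => dOp n (r + 1)).prod (vandermonde n)

end PolyForms

end

/-!
The degree bound comes from a Bézoutian argument, its sharpness from an explicit functional.
Both use the functional `altCoeff` on `ℂ[x]` that takes `f` to the coefficient of the Vandermonde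
polynomial in the antisymmetrization of `f`. It kills the multiples of symmetric polynomials
without constant term (`altCoeff_symmetric_mul`) and everything of degree above `n.choose 2`.

*The bound.* Fix `I` with `k < n` elements, by symmetry the first `k` indices. Modulo the ideal,
`∑_j Q(x_j) dx_j = 0` for every polynomial `Q` of degree less than `n`. If `Q` vanishes at the `x_j`
with `j ∉ I`, putting this sum in place of a factor of `dx_I` shows that
`∏_{j ∉ I} (x_j - x_i)`, `i ∈ I`, kills `dx_I` (`prod_compl_mem_coeffIdeal`). Together with
`n - k` combinations of power sums these are `n` homogeneous equations `F = D ℓ` in the `n`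
variables (`eqn`), with `D` triangular in suitable linear coordinates `ℓ`. Let
`θ = det (x_a ^ (b + 1))_{a, b < k}` (`powDet`), of degree `(k + 1).choose 2`. The functional
`g ↦ altCoeff (θ g)` kills the ideal `(F)`, by Cramer's rule. If it does not kill `det D`, then
`mem_span_range_of_altCoeff_det_ne_zero` applies: the Bézoutian `B(x, y)` of `F` satisfies
`f(x) B ≡ f(y) B` modulo `F(x)` and `F(y)`, and the functional, applied in `y`, gives
`f(x) b(x) ∈ (F)`, where `b(0) = altCoeff (θ det D)`, whenever `θ f` has degree above
`n.choose 2`. That `altCoeff (θ det D) ≠ 0` (`altCoeff_powDet_mul_det_ne_zero`) is seen by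
evaluating antisymmetrizations at the `n`-th roots of unity: the value is a nonzero multiple of the coefficient
of `X ^ (k + 1)` in `(X + 1) ^ n`.

*Sharpness.* The map `formDet : f dx_{i_1} ⋯ dx_{i_k} ↦ f det (x_{i_a} ^ b)`, followed by
`altCoeff`, vanishes on the ideal (`formDet_mem_altAnn`): the determinant turns a factor `dp_r` into a row of
power sums. Up to a factor, `altCoeff` is the apolar pairing with `Δ`, under which `x_i` is
adjoint to `∂_i`. Hence the functional takes `d_1 ⋯ d_k Δ` to the sum of the apolar squares of its
coefficients, up to a nonzero factor. They have integer coefficients, so this sum is positive unless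
all of them vanish, and the coefficient of `dx_0 ⋯ dx_{k-1}` is nonzero since its pairing with
`det D` is a nonzero multiple of `altCoeff (θ det D)`.
-/

namespace PolyForms

/-! ### The alternant functional and its annihilator ideal -/

/-- The exponent vector `i ↦ w i`, a rearrangement of `(0, 1, …, n - 1)`. -/
noncomputable def permExp {n : ℕ} (w : Equiv.Perm (Fin n)) : Fin n →₀ ℕ :=
  Finsupp.equivFunOnFinite.symm fun i => (w i : ℕ)

@[simp] lemma permExp_apply {n : ℕ} (w : Equiv.Perm (Fin n)) (i : Fin n) :
    permExp w i = (w i : ℕ) := rfl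

lemma permExp_injective {n : ℕ} : Function.Injective (permExp (n := n)) := by
  intro v w h
  ext i
  exact DFunLike.congr_fun h i

lemma degree_permExp {n : ℕ} (w : Equiv.Perm (Fin n)) : (permExp w).degree = n.choose 2 := by
  rw [Finsupp.degree_eq_sum]
  simp only [permExp_apply]
  rw [Equiv.sum_comp w (fun i : Fin n => (i : ℕ)), Fin.sum_univ_eq_sum_range (fun i => i) n,
    Finset.sum_range_id, Nat.choose_two_right]

/-- The functional `f ↦ ∑_w sgn(w) [x_0 ^ w(0) ⋯ x_{n-1} ^ w(n-1)] f`, defined over any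
commutative ring of coefficients. It reads off the coefficient with which the Vandermonde
polynomial occurs in the antisymmetrization of `f`. -/
noncomputable def altCoeff (n : ℕ) (K : Type*) [CommRing K] : MvPolynomial (Fin n) K →ₗ[K] K :=
  ∑ w : Equiv.Perm (Fin n), (Equiv.Perm.sign w : ℤ) • MvPolynomial.lcoeff K (permExp w)

lemma altCoeff_apply {n : ℕ} {K : Type*} [CommRing K] (f : MvPolynomial (Fin n) K) :
    altCoeff n K f =
      ∑ w : Equiv.Perm (Fin n), (Equiv.Perm.sign w : ℤ) • MvPolynomial.coeff (permExp w) f := by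
  simp [altCoeff]

lemma altCoeff_map {n : ℕ} {K L : Type*} [CommRing K] [CommRing L] (φ : K →+* L)
    (f : MvPolynomial (Fin n) K) :
    altCoeff n L (MvPolynomial.map φ f) = φ (altCoeff n K f) := by
  simp [altCoeff_apply, MvPolynomial.coeff_map, map_sum]

lemma altCoeff_rename {n : ℕ} {K : Type*} [CommRing K] (σ : Equiv.Perm (Fin n))
    (f : MvPolynomial (Fin n) K) :
    altCoeff n K (MvPolynomial.rename σ f) = (Equiv.Perm.sign σ : ℤ) • altCoeff n K f := by
  have key : ∀ w : Equiv.Perm (Fin n), permExp w = (permExp (w * σ)).mapDomain σ := by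
    intro w
    ext i
    obtain ⟨j, rfl⟩ := σ.surjective i
    rw [Finsupp.mapDomain_apply σ.injective]
    simp
  rw [altCoeff_apply, altCoeff_apply, Finset.smul_sum,
    ← Equiv.sum_comp (Equiv.mulRight σ)
      (fun w => (Equiv.Perm.sign σ : ℤ) • (Equiv.Perm.sign w : ℤ) •
        MvPolynomial.coeff (permExp w) f)]
  refine Finset.sum_congr rfl fun w _ => ?_
  rw [key w, MvPolynomial.coeff_rename_mapDomain _ σ.injective, smul_smul]
  congr 1
  simp only [Equiv.coe_mulRight, map_mul, Units.val_mul]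
  rw [mul_comm (Equiv.Perm.sign w : ℤ), ← mul_assoc, Int.units_coe_mul_self, one_mul]

/-- Distinct exponents have sum at least `0 + 1 + ⋯ + (n - 1)`, with equality only for a
rearrangement of these numbers. -/
lemma choose_two_le_sum_of_injective {n : ℕ} {b : Fin n → ℕ} (hb : Function.Injective b) :
    n.choose 2 ≤ ∑ i, b i ∧ (∑ i, b i ≤ n.choose 2 → ∀ i, b i < n) := by
  classical
  set s : Finset ℕ := Finset.univ.image b with hs
  have hcard : s.card = n := by
    rw [hs, Finset.card_image_of_injective _ hb, Finset.card_univ, Fintype.card_fin]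
  have hsum : ∑ i, b i = ∑ j : Fin n, s.orderEmbOfFin hcard j := by
    have h1 : ∑ i, b i = ∑ x ∈ s, x := by
      rw [hs, Finset.sum_image (fun _ _ _ _ h => hb h)]
    rw [h1, ← Finset.sum_coe_sort s, ← Equiv.sum_comp (s.orderIsoOfFin hcard).toEquiv]
    rfl
  have hle : ∀ j : Fin n, (j : ℕ) ≤ s.orderEmbOfFin hcard j := by
    intro j
    obtain ⟨j, hj⟩ := j
    induction j with
    | zero => exact Nat.zero_le _
    | succ j ih =>
      have h1 := ih (by omega)
      have h2 : s.orderEmbOfFin hcard ⟨j, by omega⟩ < s.orderEmbOfFin hcard ⟨j + 1, hj⟩ :=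
        (s.orderEmbOfFin hcard).strictMono (by simp [Fin.lt_def])
      simp only at h1 ⊢
      omega
  have hid : ∑ j : Fin n, (j : ℕ) = n.choose 2 := by
    rw [Fin.sum_univ_eq_sum_range (fun i => i) n, Finset.sum_range_id, Nat.choose_two_right]
  refine ⟨by rw [hsum, ← hid]; exact Finset.sum_le_sum fun j _ => hle j, fun h i => ?_⟩
  have heq : ∀ j ∈ (Finset.univ : Finset (Fin n)), (j : ℕ) = s.orderEmbOfFin hcard j :=
    (Finset.sum_eq_sum_iff_of_le fun j _ => hle j).1
      (le_antisymm (Finset.sum_le_sum fun j _ => hle j) (by rw [← hsum, hid]; exact h))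
  have hi : b i ∈ Set.range (s.orderEmbOfFin hcard) := by
    rw [Finset.range_orderEmbOfFin]
    simp [hs]
  obtain ⟨j, hj⟩ := hi
  rw [← hj, ← heq j (Finset.mem_univ j)]
  exact j.2

/-- Symmetric polynomials without constant term annihilate the alternant functional. On a monomial
`x ^ b` this holds by antisymmetry if two exponents agree, and by degree if not. -/
lemma altCoeff_symmetric_mul {n : ℕ} {s : Poly n} (hs : s.IsSymmetric)
    (h0 : MvPolynomial.constantCoeff s = 0) (g : Poly n) : altCoeff n ℂ (s * g) = 0 := by
  induction g using MvPolynomial.induction_on' with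
  | add p q hp hq => rw [mul_add, map_add, hp, hq, add_zero]
  | monomial b c =>
    by_cases hb : Function.Injective b
    · rw [altCoeff_apply]
      refine Finset.sum_eq_zero fun w _ => ?_
      rw [MvPolynomial.coeff_mul_monomial']
      split_ifs with hle
      · -- an injective exponent below a rearrangement of `0, …, n - 1` equals it
        have hsum : ∑ i, b i = ∑ i, permExp w i := by
          refine le_antisymm (Finset.sum_le_sum fun i _ => hle i) ?_
          rw [← Finsupp.degree_eq_sum, degree_permExp]
          exact (choose_two_le_sum_of_injective hb).1
        have heq : b = permExp w := by
          ext i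
          exact (Finset.sum_eq_sum_iff_of_le fun i _ => hle i).1 hsum i (Finset.mem_univ i)
        have h0' : MvPolynomial.coeff 0 s = 0 := h0
        rw [heq, tsub_self, h0', zero_mul, smul_zero]
      · exact smul_zero _
    · obtain ⟨i, j, hbij, hij⟩ : ∃ i j, b i = b j ∧ i ≠ j := by
        simpa [Function.Injective] using hb
      have hfix : b.mapDomain (Equiv.swap i j) = b := by
        ext m
        rw [Finsupp.mapDomain_equiv_apply, Equiv.symm_swap]
        rcases eq_or_ne m i with rfl | hmi
        · rw [Equiv.swap_apply_left, hbij]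
        rcases eq_or_ne m j with rfl | hmj
        · rw [Equiv.swap_apply_right, hbij]
        · rw [Equiv.swap_apply_of_ne_of_ne hmi hmj]
      have h := altCoeff_rename (Equiv.swap i j) (s * MvPolynomial.monomial b c)
      rw [map_mul, hs, MvPolynomial.rename_monomial, hfix, Equiv.Perm.sign_swap hij] at h
      simp only [Units.val_neg, Units.val_one, neg_smul, one_smul] at h
      exact self_eq_neg.1 h

/-- The ideal of polynomials all of whose multiples are killed by the alternant functional. It
contains the power sums of positive degree, and stands in for the ideal that they generate. -/
def altAnn (n : ℕ) : Ideal (Poly n) where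
  carrier := {f | ∀ g, altCoeff n ℂ (f * g) = 0}
  zero_mem' g := by simp
  add_mem' hf hg h := by rw [add_mul, map_add, hf h, hg h, add_zero]
  smul_mem' c f hf g := by rw [smul_eq_mul, mul_comm c f, mul_assoc]; exact hf _

lemma mem_altAnn {n : ℕ} {f : Poly n} : f ∈ altAnn n ↔ ∀ g, altCoeff n ℂ (f * g) = 0 := Iff.rfl

lemma psum_mem_altAnn (n r : ℕ) : MvPolynomial.psum (Fin n) ℂ (r + 1) ∈ altAnn n := fun g =>
  altCoeff_symmetric_mul (MvPolynomial.psum_isSymmetric _ _ _) (by simp [MvPolynomial.psum]) g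

/-- The annihilation survives extension of the coefficient ring. -/
lemma altCoeff_map_mul_eq_zero {n : ℕ} {K : Type*} [CommRing K] (φ : ℂ →+* K) {f : Poly n}
    (hf : f ∈ altAnn n) (g : MvPolynomial (Fin n) K) :
    altCoeff n K (MvPolynomial.map φ f * g) = 0 := by
  induction g using MvPolynomial.induction_on' with
  | add p q hp hq => rw [mul_add, map_add, hp, hq, add_zero]
  | monomial b c =>
    have h : MvPolynomial.map φ f * MvPolynomial.monomial b c
        = c • MvPolynomial.map φ (f * MvPolynomial.monomial b 1) := by
      rw [map_mul, MvPolynomial.map_monomial, map_one, ← mul_smul_comm,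
        MvPolynomial.smul_monomial, smul_eq_mul, mul_one]
    rw [h, map_smul, altCoeff_map, hf, map_zero, smul_zero]

lemma altCoeff_mul_eq_zero_of_degree {n d : ℕ} {K : Type*} [CommRing K]
    {f : MvPolynomial (Fin n) K} (hf : f.IsHomogeneous d) (hd : n.choose 2 < d)
    (g : MvPolynomial (Fin n) K) : altCoeff n K (f * g) = 0 := by
  classical
  rw [altCoeff_apply]
  refine Finset.sum_eq_zero fun w _ => ?_
  rw [MvPolynomial.coeff_mul]
  rw [Finset.sum_eq_zero, smul_zero]
  intro p hp
  rw [hf.coeff_eq_zero, zero_mul]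
  intro h
  have h2 : (p.1 + p.2).degree = n.choose 2 := by
    rw [Finset.HasAntidiagonal.mem_antidiagonal.1 hp, degree_permExp]
  rw [map_add, h] at h2
  omega

/-- For `f` homogeneous of degree `n.choose 2`, the antisymmetrization of `f` is the multiple
`altCoeff n ℂ f` of the Vandermonde determinant. -/
lemma sum_sign_eval_eq {n : ℕ} {f : Poly n} (hf : f.IsHomogeneous (n.choose 2)) (y : Fin n → ℂ) :
    ∑ w : Equiv.Perm (Fin n), (Equiv.Perm.sign w : ℤ) • MvPolynomial.eval (y ∘ w) f =
      altCoeff n ℂ f * (Matrix.vandermonde y).det := by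
  classical
  have key : ∀ b : Fin n →₀ ℕ, b.degree = n.choose 2 →
      ∑ w : Equiv.Perm (Fin n), (Equiv.Perm.sign w : ℤ) • ∏ i, y (w i) ^ b i =
        altCoeff n ℂ (MvPolynomial.monomial b 1) * (Matrix.vandermonde y).det := by
    intro b hbdeg
    have hdet : ∑ w : Equiv.Perm (Fin n), (Equiv.Perm.sign w : ℤ) • ∏ i, y (w i) ^ b i =
        (Matrix.of fun i j => y i ^ b j).det := by
      rw [Matrix.det_apply]
      rfl
    rw [hdet]
    by_cases hb : Function.Injective b
    · have hlt := (choose_two_le_sum_of_injective hb).2 (by rw [← hbdeg, Finsupp.degree_eq_sum])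
      set u : Equiv.Perm (Fin n) := Equiv.ofBijective (fun i => (⟨b i, hlt i⟩ : Fin n))
        (Finite.injective_iff_bijective.1 fun i j h => hb (by simpa using h)) with hu
      have hbu : b = permExp u := by
        ext i
        simp [hu]
      have h1 : (Matrix.of fun i j => y i ^ b j) = (Matrix.vandermonde y).submatrix id u := by
        ext i j
        simp [hbu, Matrix.vandermonde_apply]
      rw [h1, Matrix.det_permute', altCoeff_apply, Finset.sum_eq_single u]
      · simp [hbu]
      · intro w _ hw
        rw [hbu, MvPolynomial.coeff_monomial, if_neg, smul_zero]
        exact fun h => hw (permExp_injective h).symm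
      · simp
    · obtain ⟨i, j, hbij, hij⟩ : ∃ i j, b i = b j ∧ i ≠ j := by
        simpa [Function.Injective] using hb
      rw [Matrix.det_zero_of_column_eq hij fun a => by simp [hbij], altCoeff_apply,
        Finset.sum_eq_zero, zero_mul]
      intro w _
      rw [MvPolynomial.coeff_monomial, if_neg, smul_zero]
      intro h
      apply hij
      apply w.injective
      rw [h] at hbij
      exact Fin.ext hbij
  have hR : altCoeff n ℂ f =
      ∑ b ∈ f.support, f.coeff b * altCoeff n ℂ (MvPolynomial.monomial b 1) := by
    conv_lhs => rw [f.as_sum]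
    rw [map_sum]
    refine Finset.sum_congr rfl fun b _ => ?_
    rw [← smul_eq_mul, ← map_smul, MvPolynomial.smul_monomial, smul_eq_mul, mul_one]
  rw [hR, Finset.sum_mul]
  simp only [MvPolynomial.eval_eq', Finset.smul_sum]
  rw [Finset.sum_comm]
  refine Finset.sum_congr rfl fun b hb => ?_
  have hdeg : b.degree = n.choose 2 := by
    by_contra h
    exact MvPolynomial.mem_support_iff.1 hb (hf.coeff_eq_zero h)
  rw [mul_assoc, ← key b hdeg, Finset.mul_sum]
  refine Finset.sum_congr rfl fun w _ => ?_
  rw [mul_smul_comm]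
  rfl

/-! ### A Bézoutian criterion for membership in an ideal -/

section Bezoutian

open MvPolynomial

/-- Two ring homomorphisms `φ, ψ`, thought of as evaluation at `x` and at `y`, are given such that
`φ p - ψ p` always is a combination of the `φ ℓ_j - ψ ℓ_j`. If `F = D ℓ`, then some matrix `Δ`
congruent to `ψ D` modulo the `φ ℓ_j` takes the differences of `ℓ` to those of `F`, and by Cramer's
rule `det Δ * (φ p - ψ p)` is a combination of the `φ F_i - ψ F_i`. -/
lemma exists_bezoutian {ι R A : Type*} [Fintype ι] [DecidableEq ι] [CommRing R] [CommRing A]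
    (φ ψ : R →+* A) {F ℓ : ι → R} {D : Matrix ι ι R} (hF : F = D.mulVec ℓ)
    (hspan : ∀ p, φ p - ψ p ∈ Ideal.span (Set.range fun j => φ (ℓ j) - ψ (ℓ j))) :
    ∃ (Δ : Matrix ι ι A) (E : ι → ι → ι → A),
      (∀ i l, Δ i l = ψ (D i l) + ∑ j, E i j l * φ (ℓ j)) ∧
      ∀ p, ∃ h : ι → A, Δ.det * (φ p - ψ p) = ∑ i, h i * (φ (F i) - ψ (F i)) := by
  have hE : ∀ i j, ∃ c : ι → A, ∑ l, c l * (φ (ℓ l) - ψ (ℓ l)) = φ (D i j) - ψ (D i j) :=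
    fun i j => (Ideal.mem_span_range_iff_exists_fun).1 (hspan (D i j))
  choose E hE using hE
  set Δ : Matrix ι ι A := Matrix.of fun i l => ψ (D i l) + ∑ j, E i j l * φ (ℓ j) with hΔ
  refine ⟨Δ, E, fun i l => rfl, fun p => ?_⟩
  have hΔmul : ∀ i, ∑ l, Δ i l * (φ (ℓ l) - ψ (ℓ l)) = φ (F i) - ψ (F i) := by
    intro i
    have h1 : ∑ l, Δ i l * (φ (ℓ l) - ψ (ℓ l)) = ∑ l, ψ (D i l) * (φ (ℓ l) - ψ (ℓ l)) +
        ∑ j, (φ (D i j) - ψ (D i j)) * φ (ℓ j) := by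
      simp only [hΔ, Matrix.of_apply, add_mul, Finset.sum_add_distrib]
      congr 1
      simp only [Finset.sum_mul]
      rw [Finset.sum_comm]
      refine Finset.sum_congr rfl fun j _ => ?_
      rw [← hE i j, Finset.sum_mul]
      exact Finset.sum_congr rfl fun l _ => by ring
    rw [h1, hF, ← Finset.sum_add_distrib]
    simp only [Matrix.mulVec, dotProduct, map_sum, ← Finset.sum_sub_distrib]
    refine Finset.sum_congr rfl fun j _ => ?_
    simp only [map_mul]
    ring
  have hcramer : ∀ j, Δ.det * (φ (ℓ j) - ψ (ℓ j)) =
      ∑ i, Δ.adjugate j i * (φ (F i) - ψ (F i)) := by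
    intro j
    have h : Δ.adjugate.mulVec (Δ.mulVec fun l => φ (ℓ l) - ψ (ℓ l)) =
        Δ.det • fun l => φ (ℓ l) - ψ (ℓ l) := by
      rw [Matrix.mulVec_mulVec, Matrix.adjugate_mul, Matrix.smul_mulVec, Matrix.one_mulVec]
    have h2 := congrFun h j
    rw [Pi.smul_apply, smul_eq_mul] at h2
    rw [← h2]
    exact Finset.sum_congr rfl fun i _ => by rw [← hΔmul i]; rfl
  obtain ⟨c, hc⟩ := (Ideal.mem_span_range_iff_exists_fun).1 (hspan p)
  refine ⟨fun i => ∑ j, c j * Δ.adjugate j i, ?_⟩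
  rw [← hc, Finset.mul_sum]
  simp only [Finset.sum_mul]
  rw [Finset.sum_comm]
  refine Finset.sum_congr rfl fun j _ => ?_
  rw [mul_left_comm, hcramer j, Finset.mul_sum]
  exact Finset.sum_congr rfl fun i _ => by ring

/-- In `ℂ[x][y]`, the difference `p(x) - p(y)` is a combination of the differences
`ℓ_j(x) - ℓ_j(y)` for any linear coordinates `ℓ_j`. -/
lemma C_sub_map_C_mem_span {n : ℕ} {ℓ : Fin n → Poly n} {U : Matrix (Fin n) (Fin n) ℂ}
    (hU : ∀ i, (X i : Poly n) = ∑ j, U i j • ℓ j) (p : Poly n) :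
    (C p - map C p : MvPolynomial (Fin n) (Poly n)) ∈
      Ideal.span (Set.range fun j => (C (ℓ j) - map C (ℓ j) : MvPolynomial (Fin n) (Poly n))) := by
  set S := Ideal.span
    (Set.range fun j => (C (ℓ j) - map C (ℓ j) : MvPolynomial (Fin n) (Poly n))) with hS
  induction p using MvPolynomial.induction_on with
  | C a => simp
  | add p q hp hq =>
    have := S.add_mem hp hq
    convert this using 1
    simp only [map_add]
    ring
  | mul_X p i hp =>
    have hX : (C (X i) - map C (X i : Poly n) : MvPolynomial (Fin n) (Poly n)) ∈ S := by
      have h : (C (X i) - map C (X i : Poly n) : MvPolynomial (Fin n) (Poly n)) =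
          ∑ j, C (C (U i j)) * (C (ℓ j) - map C (ℓ j)) := by
        conv_lhs => rw [hU i]
        simp only [map_sum, MvPolynomial.smul_eq_C_mul, map_mul, map_C, ← Finset.sum_sub_distrib,
          mul_sub]
      rw [h]
      exact S.sum_mem fun j _ => S.mul_mem_left _ (Ideal.subset_span ⟨j, rfl⟩)
    have := S.add_mem (S.mul_mem_right (C (X i)) hp) (S.mul_mem_left (map C p) hX)
    convert this using 1
    simp only [map_mul]
    ring

/-- Let `F = D ℓ` with `ℓ` linear coordinates, and suppose that the functional
`g ↦ altCoeff (θ g)` kills the ideal `(F)` but not `det D`. Then every homogeneous `f` such that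
`θ f` is of degree above the socle degree `n.choose 2` lies in `(F)`.

The Bézoutian `B(x, y) ∈ ℂ[x][y]` of `F` satisfies `f(x) B ≡ f(y) B` modulo `F(x), F(y)`;
applying the functional in the variables `y` gives `f(x) b(x) ∈ (F)`, and `b` has the nonzero
constant term `altCoeff (θ det D)`. -/
theorem mem_span_range_of_altCoeff_det_ne_zero {n : ℕ} {F ℓ : Fin n → Poly n}
    {D : Matrix (Fin n) (Fin n) (Poly n)} {U : Matrix (Fin n) (Fin n) ℂ} {θ : Poly n} {a d : ℕ}
    (hFhom : ∀ i, ∃ e, (F i).IsHomogeneous e) (hF : F = D.mulVec ℓ)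
    (hU : ∀ i, (X i : Poly n) = ∑ j, U i j • ℓ j) (hℓ : ∀ j, constantCoeff (ℓ j) = 0)
    (hann : ∀ i, F i * θ ∈ altAnn n) (hne : altCoeff n ℂ (θ * D.det) ≠ 0)
    (hθ : θ.IsHomogeneous a) {f : Poly n} (hf : f.IsHomogeneous d) (hd : n.choose 2 < d + a) :
    f ∈ Ideal.span (Set.range F) := by
  classical
  obtain ⟨Δ, E, hΔ, hΔspan⟩ := exists_bezoutian
    (C : Poly n →+* MvPolynomial (Fin n) (Poly n)) (map C) hF (C_sub_map_C_mem_span hU)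
  obtain ⟨h, hh⟩ := hΔspan f
  set B := Δ.det with hB
  set τ := altCoeff n (Poly n) with hτ
  set b : Poly n := τ (map C θ * B) with hb
  have hfb : f * b = ∑ i, F i * τ (map C θ * h i) := by
    have e1 : C f * (map C θ * B) = map C (f * θ) * B +
        ∑ i, (C (F i) * (map C θ * h i) - map C (F i * θ) * h i) := by
      have e2 : ∑ i, (C (F i) * (map C θ * h i) - map C (F i * θ) * h i) =
          map C θ * ∑ i, h i * (C (F i) - map C (F i)) := by
        rw [Finset.mul_sum]
        refine Finset.sum_congr rfl fun i _ => ?_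
        rw [map_mul]
        ring
      rw [e2, ← hh, map_mul]
      ring
    have e3 := congrArg τ e1
    rw [← MvPolynomial.smul_eq_C_mul, map_smul, map_add, map_sum,
      altCoeff_mul_eq_zero_of_degree ((hf.mul hθ).map _) hd, zero_add, smul_eq_mul] at e3
    rw [e3]
    refine Finset.sum_congr rfl fun i _ => ?_
    rw [map_sub, ← MvPolynomial.smul_eq_C_mul, map_smul, altCoeff_map_mul_eq_zero _ (hann i),
      sub_zero, smul_eq_mul]
  have hb0 : constantCoeff b = altCoeff n ℂ (θ * D.det) := by
    have hid : ∀ p : Poly n, map constantCoeff (map C p : MvPolynomial (Fin n) (Poly n)) = p := by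
      intro p
      rw [MvPolynomial.map_map]
      have : (constantCoeff : Poly n →+* ℂ).comp C = RingHom.id ℂ := by
        ext
        simp
      rw [this, MvPolynomial.map_id]
    have hdet : map constantCoeff B = D.det := by
      rw [hB, RingHom.map_det]
      congr 1
      ext1 i l
      simp only [hΔ, RingHom.mapMatrix_apply, Matrix.map_apply, map_add, hid,
        map_sum, map_mul, map_C, hℓ, map_zero, mul_zero, Finset.sum_const_zero, add_zero]
    rw [hb, hτ, ← altCoeff_map, map_mul, hid, hdet]
  have hmem : f * b ∈ Ideal.span (Set.range F) := by
    rw [hfb]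
    exact Ideal.sum_mem _ fun i _ => Ideal.mul_mem_right _ _ (Ideal.subset_span ⟨i, rfl⟩)
  let _ : GradedAlgebra (homogeneousSubmodule (Fin n) ℂ) := gradedAlgebra
  -- the lowest component of `f * b` is a nonzero multiple of `f`
  have hI : (Ideal.span (Set.range F)).IsHomogeneous (homogeneousSubmodule (Fin n) ℂ) :=
    Ideal.homogeneous_span _ _ (by rintro _ ⟨i, rfl⟩; exact hFhom i)
  have h1 := hI d hmem
  have hf' : f ∈ homogeneousSubmodule (Fin n) ℂ d := hf
  have h2 := DirectSum.coe_decompose_mul_add_of_left_mem (homogeneousSubmodule (Fin n) ℂ)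
    (j := 0) (b := b) hf'
  rw [add_zero] at h2
  rw [h2] at h1
  have h3 : ((DirectSum.decompose (homogeneousSubmodule (Fin n) ℂ) b 0 :
      homogeneousSubmodule (Fin n) ℂ 0) : Poly n) = C (constantCoeff b) := by
    have : ((DirectSum.decompose (homogeneousSubmodule (Fin n) ℂ) b 0 :
      homogeneousSubmodule (Fin n) ℂ 0) : Poly n) = homogeneousComponent 0 b :=
        decomposition.decompose'_apply b 0
    rw [this, homogeneousComponent_zero]
    rfl
  rw [h3, hb0] at h1
  have h4 := Ideal.mul_mem_right (C (altCoeff n ℂ (θ * D.det))⁻¹) _ h1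
  rwa [mul_assoc, ← C_mul, mul_inv_cancel₀ hne, C_1, mul_one] at h4

end Bezoutian

/-! ### A sum over roots of unity -/

section RootsOfUnity

/-- An enumeration of the complex `n`-th roots of unity. -/
noncomputable def rootEnum (n : ℕ) (j : Fin n) : ℂ :=
  Complex.exp (2 * Real.pi * Complex.I / n) ^ (j : ℕ)

lemma rootEnum_injective (n : ℕ) : Function.Injective (rootEnum n) := by
  intro i j h
  have hζ := Complex.isPrimitiveRoot_exp n (by have := i.pos; omega)
  exact Fin.ext (hζ.pow_inj i.2 j.2 h)

lemma rootEnum_pow (n : ℕ) (j : Fin n) : rootEnum n j ^ n = 1 := by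
  have hζ := Complex.isPrimitiveRoot_exp n (by have := j.pos; omega)
  rw [rootEnum, pow_right_comm, hζ.pow_eq_one, one_pow]

lemma prod_sub_mul_rootEnum {n : ℕ} (hn : 0 < n) {A : Type*} [CommRing A] [IsDomain A]
    {φ : ℂ →+* A} (a b : A) :
    ∏ j, (a - φ (rootEnum n j) * b) = a ^ n - b ^ n := by
  classical
  have hζ : IsPrimitiveRoot (φ (Complex.exp (2 * Real.pi * Complex.I / n))) n :=
    (Complex.isPrimitiveRoot_exp n (by omega)).map_of_injective φ.injective
  rw [hζ.pow_sub_pow_eq_prod_sub_mul a b hn]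
  have hinj : Function.Injective fun j => φ (rootEnum n j) :=
    φ.injective.comp (rootEnum_injective n)
  have himg : (Finset.univ.image fun j => φ (rootEnum n j)) =
      Polynomial.nthRootsFinset n (1 : A) := by
    apply Finset.eq_of_subset_of_card_le
    · intro x hx
      obtain ⟨j, -, rfl⟩ := Finset.mem_image.1 hx
      rw [Polynomial.mem_nthRootsFinset hn, ← map_pow, rootEnum_pow, map_one]
    · rw [Finset.card_image_of_injective _ hinj, hζ.card_nthRootsFinset]
      simp
  rw [← himg, Finset.prod_image fun _ _ _ _ h => hinj h]

lemma rootEnum_mul_prod_sub {n : ℕ} (k : Fin n) (w : Equiv.Perm (Fin n)) :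
    rootEnum n (w k) * ∏ j ∈ Finset.univ.erase k, (rootEnum n (w k) - rootEnum n (w j)) = n := by
  have hpos := k.pos
  have h := congrArg Polynomial.derivative
    (prod_sub_mul_rootEnum hpos (φ := Polynomial.C) (Polynomial.X : Polynomial ℂ) 1)
  have h1 : ∏ j, ((Polynomial.X : Polynomial ℂ) - Polynomial.C (rootEnum n j) * 1) =
      Lagrange.nodal Finset.univ (rootEnum n ∘ w) := by
    rw [Lagrange.nodal, ← Equiv.prod_comp w]
    simp
  rw [h1] at h
  have h2 := congrArg (Polynomial.eval ((rootEnum n ∘ w) k)) h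
  rw [Lagrange.eval_nodal_derivative_eval_node_eq (Finset.mem_univ k), Lagrange.eval_nodal] at h2
  simp only [Function.comp_apply] at h2
  rw [h2]
  simp only [one_pow, Polynomial.derivative_sub, Polynomial.derivative_X_pow,
    Polynomial.derivative_one, sub_zero, Polynomial.eval_mul, Polynomial.eval_pow,
    Polynomial.eval_X, Polynomial.eval_C]
  rw [mul_left_comm, ← pow_succ', Nat.sub_add_cancel hpos, rootEnum_pow, mul_one]

/-- The product of the `y_i` over `T` times `∑_l ∏_{j ∉ T} (y_j - y_l)`; only the terms with
`l ∈ T` contribute. -/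
noncomputable def subsetSum {n : ℕ} (y : Fin n → ℂ) (T : Finset (Fin n)) : ℂ :=
  (∏ i ∈ T, y i) * ∑ l, ∏ j ∈ Tᶜ, (y j - y l)

lemma subsetSum_comp {n : ℕ} (y : Fin n → ℂ) (w : Equiv.Perm (Fin n)) (T : Finset (Fin n)) :
    subsetSum (y ∘ w) T = subsetSum y (T.map w.toEmbedding) := by
  classical
  have hc : (T.map w.toEmbedding)ᶜ = Tᶜ.map w.toEmbedding := by
    ext x
    obtain ⟨x, rfl⟩ := w.surjective x
    simp
  simp only [subsetSum, hc, Finset.prod_map, Function.comp_apply, Equiv.coe_toEmbedding]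
  rw [Equiv.sum_comp w fun l => ∏ j ∈ Tᶜ, (y (w j) - y l)]

/-- The sum of `subsetSum` over the subsets of size `m` is the coefficient of `X ^ m` in
`∑_l ∏_j ((X + 1) y_j - y_l) = ± n (1 - (X + 1) ^ n)`. -/
lemma sum_subsetSum_rootEnum_ne_zero {n m : ℕ} (hm : 0 < m) (hmn : m ≤ n) :
    ∑ T ∈ (Finset.univ : Finset (Fin n)).powersetCard m, subsetSum (rootEnum n) T ≠ 0 := by
  classical
  have hn : 0 < n := by omega
  set y := rootEnum n with hy
  have hl : ∀ l, ∑ T ∈ (Finset.univ : Finset (Fin n)).powersetCard m,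
      (∏ i ∈ T, y i) * ∏ j ∈ Tᶜ, (y j - y l) = -(-1) ^ n * (n.choose m : ℂ) := by
    intro l
    have hP : ∏ j, (Polynomial.X * Polynomial.C (y j) + Polynomial.C (y j - y l)) =
        (-1) ^ n * (1 - (Polynomial.X + 1) ^ n) := by
      have h := prod_sub_mul_rootEnum hn (φ := Polynomial.C) (Polynomial.C (y l))
        (Polynomial.X + 1 : Polynomial ℂ)
      rw [← map_pow, rootEnum_pow, map_one] at h
      rw [← h]
      have h2 : ((-1) ^ n : Polynomial ℂ) = ∏ _j : Fin n, (-1 : Polynomial ℂ) := by simp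
      rw [h2, ← Finset.prod_mul_distrib]
      refine Finset.prod_congr rfl fun j _ => ?_
      rw [map_sub]
      ring
    have hcoeff := congrArg (fun p => Polynomial.coeff p m) hP
    rw [Finset.prod_add, Polynomial.finsetSum_coeff] at hcoeff
    have hterm : ∀ T : Finset (Fin n), (((∏ i ∈ T, (Polynomial.X * Polynomial.C (y i))) *
        ∏ i ∈ Finset.univ \ T, Polynomial.C (y i - y l)).coeff m) =
        if T.card = m then (∏ i ∈ T, y i) * ∏ j ∈ Tᶜ, (y j - y l) else 0 := by
      intro T
      rw [Finset.prod_mul_distrib, Finset.prod_const, ← map_prod, ← map_prod, mul_assoc,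
        ← map_mul, Polynomial.coeff_X_pow_mul', Polynomial.coeff_C, Finset.compl_eq_univ_sdiff]
      by_cases h : T.card = m
      · simp [h]
      · rw [if_neg h]
        split_ifs <;> first | rfl | omega
    rw [Finset.sum_congr rfl fun T _ => hterm T, ← Finset.sum_filter] at hcoeff
    have hfil : (Finset.univ : Finset (Fin n)).powerset.filter (fun T => T.card = m) =
        (Finset.univ : Finset (Fin n)).powersetCard m := by
      ext T
      simp [Finset.mem_powersetCard]
    rw [hfil] at hcoeff
    rw [hcoeff]
    have h3 : ((-1) ^ n : Polynomial ℂ) = Polynomial.C ((-1) ^ n) := by simp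
    rw [h3, Polynomial.coeff_C_mul, Polynomial.coeff_sub, Polynomial.coeff_X_add_one_pow,
      Polynomial.coeff_one, if_neg (by omega)]
    ring
  simp only [subsetSum, Finset.mul_sum]
  rw [Finset.sum_comm, Finset.sum_congr rfl fun l _ => hl l]
  have h1 : ((n.choose m : ℕ) : ℂ) ≠ 0 := by
    exact_mod_cast (Nat.choose_pos hmn).ne'
  have h2 : (n : ℂ) ≠ 0 := by exact_mod_cast hn.ne'
  simp [h1, h2]

lemma sum_perm_subsetSum_rootEnum_ne_zero {n : ℕ} {T : Finset (Fin n)} (hT : T.Nonempty) :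
    ∑ w : Equiv.Perm (Fin n), subsetSum (rootEnum n ∘ w) T ≠ 0 := by
  classical
  intro h0
  have hall : ∀ T' : Finset (Fin n), T'.card = T.card →
      ∑ w : Equiv.Perm (Fin n), subsetSum (rootEnum n ∘ w) T' = 0 := by
    intro T' hT'
    obtain ⟨σ, hσ⟩ : ∃ σ : Equiv.Perm (Fin n), T.map σ.toEmbedding = T' := by
      have e : {x // x ∈ T} ≃ {x // x ∈ T'} := Finset.equivOfCardEq hT'.symm
      refine ⟨e.extendSubtype, ?_⟩
      apply Finset.eq_of_subset_of_card_le
      · intro x hx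
        obtain ⟨a, ha, rfl⟩ := Finset.mem_map.1 hx
        exact e.extendSubtype_mem a ha
      · rw [Finset.card_map, hT']
    rw [← h0, ← Equiv.sum_comp (Equiv.mulRight σ) fun w => subsetSum (rootEnum n ∘ w) T]
    refine Finset.sum_congr rfl fun w _ => ?_
    rw [← hσ, ← subsetSum_comp]
    rfl
  have hsum : ∑ T' ∈ (Finset.univ : Finset (Fin n)).powersetCard T.card,
      ∑ w : Equiv.Perm (Fin n), subsetSum (rootEnum n ∘ w) T' = 0 :=
    Finset.sum_eq_zero fun T' hT' => hall T' (Finset.mem_powersetCard.1 hT').2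
  rw [Finset.sum_comm] at hsum
  have hinner : ∀ w : Equiv.Perm (Fin n),
      ∑ T' ∈ (Finset.univ : Finset (Fin n)).powersetCard T.card, subsetSum (rootEnum n ∘ w) T' =
      ∑ T' ∈ (Finset.univ : Finset (Fin n)).powersetCard T.card, subsetSum (rootEnum n) T' := by
    intro w
    refine Finset.sum_equiv w.finsetCongr (fun T' => ?_) fun T' _ => ?_
    · simp [Finset.mem_powersetCard]
    · rw [subsetSum_comp]
      rfl
  rw [Finset.sum_congr rfl fun w _ => hinner w, Finset.sum_const, nsmul_eq_mul] at hsum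
  rcases mul_eq_zero.1 hsum with h | h
  · have : (Fintype.card (Equiv.Perm (Fin n)) : ℂ) ≠ 0 := by
      exact_mod_cast Fintype.card_ne_zero
    exact this (by rwa [Finset.card_univ] at h)
  · exact sum_subsetSum_rootEnum_ne_zero hT.card_pos (by simpa using T.card_le_univ) h

end RootsOfUnity

/-! ### A system of equations for the coefficients of a fixed `dx_I` -/

section System

open MvPolynomial

variable {n : ℕ}

lemma sum_eval_X_mul_pow (Q : Polynomial (Poly n)) (b : ℕ) :
    ∑ j, Q.eval (X j) * (X j : Poly n) ^ b =
      ∑ r ∈ Finset.range (Q.natDegree + 1), Q.coeff r * psum (Fin n) ℂ (r + b) := by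
  simp only [Polynomial.eval_eq_sum_range, Finset.sum_mul, psum, Finset.mul_sum]
  rw [Finset.sum_comm]
  refine Finset.sum_congr rfl fun r _ => Finset.sum_congr rfl fun j _ => ?_
  rw [pow_add, mul_assoc]

/-- The polynomial `∏_{l ∈ s} (x_l - t)` in the variable `t`. -/
noncomputable def revNodal (s : Finset (Fin n)) : Polynomial (Poly n) :=
  ∏ l ∈ s, (Polynomial.C (X l) - Polynomial.X)

lemma eval_revNodal (s : Finset (Fin n)) (t : Poly n) :
    (revNodal s).eval t = ∏ l ∈ s, (X l - t) := by
  simp [revNodal, Polynomial.eval_prod]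

lemma natDegree_revNodal_le (s : Finset (Fin n)) : (revNodal s).natDegree ≤ s.card := by
  refine (Polynomial.natDegree_prod_le _ _).trans ?_
  refine (Finset.sum_le_card_nsmul _ _ 1 fun l _ => ?_).trans (by simp)
  exact (Polynomial.natDegree_sub_le _ _).trans (by simp)

lemma prod_X_sub_eq_zero {s : Finset (Fin n)} {j : Fin n} (hj : j ∈ s) :
    ∏ l ∈ s, (X l - X j : Poly n) = 0 :=
  Finset.prod_eq_zero hj (sub_self _)

lemma isHomogeneous_prod_X_sub (s : Finset (Fin n)) (j : Fin n) :
    (∏ l ∈ s, (X l - X j : Poly n)).IsHomogeneous s.card := by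
  have h := IsHomogeneous.prod s (fun l => (X l - X j : Poly n)) (fun _ => 1)
    fun l _ => (isHomogeneous_X _ _).sub (isHomogeneous_X _ _)
  simpa using h

/-- The determinant of the matrix `(x_a ^ (b + 1))` for `a, b < k`. Applied as a differential
operator to the Vandermonde polynomial it gives a coefficient of `d_1 ⋯ d_k Δ`. -/
noncomputable def powDet {k : ℕ} (hk : k ≤ n) : Poly n :=
  (Matrix.of fun a b : Fin k => (X (Fin.castLE hk a) : Poly n) ^ ((b : ℕ) + 1)).det

lemma isHomogeneous_powDet {k : ℕ} (hk : k ≤ n) :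
    (powDet hk).IsHomogeneous ((k + 1).choose 2) := by
  rw [powDet, Matrix.det_apply]
  refine IsHomogeneous.sum _ _ _ fun σ _ => ?_
  have h : (∏ i : Fin k, (X (Fin.castLE hk (σ i)) : Poly n) ^ ((i : ℕ) + 1)).IsHomogeneous
      ((k + 1).choose 2) := by
    have h1 := IsHomogeneous.prod Finset.univ
      (fun i : Fin k => (X (Fin.castLE hk (σ i)) : Poly n) ^ ((i : ℕ) + 1)) (fun i => (i : ℕ) + 1)
      fun i _ => isHomogeneous_X_pow _ _
    convert h1 using 1
    rw [Fin.sum_univ_eq_sum_range (fun i => i + 1) k, Nat.choose_two_right, ← Finset.sum_range_id,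
      Finset.sum_range_succ']
    simp
  rw [Units.smul_def]
  exact (homogeneousSubmodule (Fin n) ℂ _).toAddSubgroup.zsmul_mem h _

variable (k : Fin n)

/-- The `n` polynomials by which `dx_0 ∧ ⋯ ∧ dx_{k-1}` is annihilated modulo the ideal:
the products `∏_{j ≥ k} (x_j - x_i)` for `i < k`, and `∑_j ∏_{l > i} (x_l - x_j) x_j` for `i ≥ k`,
which is a combination of power sums. -/
noncomputable def eqn (i : Fin n) : Poly n :=
  if i < k then (∏ j ∈ Finset.Ioi k, (X j - X i)) * (X k - X i)
  else ∑ j, (∏ l ∈ Finset.Ioi i, (X l - X j)) * X j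

/-- Linear coordinates in which `eqn` is given by a triangular matrix. -/
noncomputable def coord (i : Fin n) : Poly n := if i < k then X k - X i else X i

/-- The lower triangular matrix that expresses `eqn` in terms of `coord`. -/
noncomputable def eqnMatrix : Matrix (Fin n) (Fin n) (Poly n) :=
  Matrix.of fun i j =>
    if i < k then (if j = i then ∏ l ∈ Finset.Ioi k, (X l - X i) else 0)
    else if j < k then -∏ l ∈ Finset.Ioi i, (X l - X j)
    else if j = k then ∑ m ∈ Finset.Iic k, ∏ l ∈ Finset.Ioi i, (X l - X m)
    else ∏ l ∈ Finset.Ioi i, (X l - X j)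

lemma sum_eq_Iio_add_add_Ioi {M : Type*} [AddCommMonoid M] (g : Fin n → M) :
    ∑ i, g i = ∑ i ∈ Finset.Iio k, g i + g k + ∑ i ∈ Finset.Ioi k, g i := by
  classical
  have h1 : (Finset.univ : Finset (Fin n)) = Finset.Iic k ∪ Finset.Ioi k := by
    ext i; simp [le_or_gt]
  have h2 : Finset.Iic k = insert k (Finset.Iio k) := by
    ext i; simp [le_iff_eq_or_lt]
  rw [h1, Finset.sum_union, h2, Finset.sum_insert (by simp), add_comm (g k)]
  rw [Finset.disjoint_left]
  intro i hi hi'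
  simp only [Finset.mem_Iic, Finset.mem_Ioi] at hi hi'
  omega

lemma prod_eq_Iio_mul_mul_Ioi {M : Type*} [CommMonoid M] (g : Fin n → M) :
    ∏ i, g i = (∏ i ∈ Finset.Iio k, g i) * g k * ∏ i ∈ Finset.Ioi k, g i :=
  sum_eq_Iio_add_add_Ioi (M := Additive M) k g

lemma sum_Iic_eq {M : Type*} [AddCommMonoid M] (g : Fin n → M) :
    ∑ i ∈ Finset.Iic k, g i = ∑ i ∈ Finset.Iio k, g i + g k := by
  classical
  have h2 : Finset.Iic k = insert k (Finset.Iio k) := by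
    ext i; simp [le_iff_eq_or_lt]
  rw [h2, Finset.sum_insert (by simp), add_comm (g k)]

lemma eqn_eq_mulVec : eqn k = (eqnMatrix k).mulVec (coord k) := by
  classical
  funext i
  simp only [Matrix.mulVec, dotProduct, eqnMatrix, Matrix.of_apply, eqn, coord]
  by_cases hi : i < k
  · simp only [if_pos hi, ite_mul, zero_mul]
    rw [Finset.sum_ite_eq' Finset.univ i]
    simp [hi]
  · simp only [if_neg hi]
    rw [sum_eq_Iio_add_add_Ioi k, sum_eq_Iio_add_add_Ioi k]
    simp only [lt_self_iff_false, if_false, if_true]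
    congr 1
    · rw [sum_Iic_eq, add_mul, ← add_assoc]
      congr 1
      rw [Finset.sum_mul, ← Finset.sum_add_distrib]
      refine Finset.sum_congr rfl fun j hj => ?_
      rw [Finset.mem_Iio] at hj
      rw [if_pos hj, if_pos hj]
      ring
    · refine Finset.sum_congr rfl fun j hj => ?_
      rw [Finset.mem_Ioi] at hj
      rw [if_neg hj.not_gt, if_neg hj.not_gt, if_neg hj.ne']

lemma det_eqnMatrix : (eqnMatrix k).det =
    (∏ i ∈ Finset.Iio k, ∏ l ∈ Finset.Ioi k, (X l - X i)) *
      (∑ m ∈ Finset.Iic k, ∏ l ∈ Finset.Ioi k, (X l - X m)) *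
      ∏ i ∈ Finset.Ioi k, ∏ l ∈ Finset.Ioi i, (X l - X i) := by
  classical
  rw [Matrix.det_of_isLowerTriangular, prod_eq_Iio_mul_mul_Ioi k]
  · congr 1
    · congr 1
      · refine Finset.prod_congr rfl fun i hi => ?_
        rw [Finset.mem_Iio] at hi
        simp [eqnMatrix, hi]
      · simp [eqnMatrix]
    · refine Finset.prod_congr rfl fun i hi => ?_
      rw [Finset.mem_Ioi] at hi
      simp [eqnMatrix, hi.not_gt, hi.ne']
  · intro i j hij
    have hij : i < j := hij
    simp only [eqnMatrix, Matrix.of_apply]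
    by_cases hi : i < k
    · rw [if_pos hi, if_neg hij.ne']
    · have h1 : k < j := lt_of_le_of_lt (not_lt.1 hi) hij
      rw [if_neg hi, if_neg h1.not_gt, if_neg h1.ne', prod_X_sub_eq_zero (Finset.mem_Ioi.2 hij)]

lemma exists_X_eq_sum_coord :
    ∃ U : Matrix (Fin n) (Fin n) ℂ, ∀ i, (X i : Poly n) = ∑ j, U i j • coord k j := by
  classical
  refine ⟨Matrix.of fun i j => if i < k then (if j = k then 1 else 0) - (if j = i then 1 else 0)
    else if j = i then 1 else 0, fun i => ?_⟩
  by_cases hi : i < k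
  · simp only [Matrix.of_apply, if_pos hi, sub_smul, ite_smul, one_smul, zero_smul,
      Finset.sum_sub_distrib, Finset.sum_ite_eq', Finset.mem_univ, if_true]
    simp [coord, hi]
  · simp only [Matrix.of_apply, if_neg hi, ite_smul, one_smul, zero_smul,
      Finset.sum_ite_eq', Finset.mem_univ, if_true]
    simp [coord, hi]

lemma eqn_mem_span_psum {i : Fin n} (hi : ¬ i < k) :
    eqn k i ∈ Ideal.span ((fun r => psum (Fin n) ℂ r) '' Set.Icc 1 n) := by
  have h : eqn k i = ∑ j, (revNodal (Finset.Ioi i)).eval (X j) * (X j : Poly n) ^ 1 := by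
    simp only [eqn, if_neg hi, eval_revNodal, pow_one]
  rw [h, sum_eval_X_mul_pow]
  refine Ideal.sum_mem _ fun r hr => Ideal.mul_mem_left _ _ (Ideal.subset_span ⟨r + 1, ?_, rfl⟩)
  have h1 := natDegree_revNodal_le (Finset.Ioi i)
  rw [Fin.card_Ioi] at h1
  rw [Finset.mem_range] at hr
  have := i.2
  exact ⟨by omega, by omega⟩

lemma isHomogeneous_eqn (i : Fin n) : ∃ e, (eqn k i).IsHomogeneous e := by
  by_cases hi : i < k
  · refine ⟨(Finset.Ioi k).card + 1, ?_⟩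
    rw [eqn, if_pos hi]
    exact (isHomogeneous_prod_X_sub _ _).mul ((isHomogeneous_X _ _).sub (isHomogeneous_X _ _))
  · refine ⟨(Finset.Ioi i).card + 1, ?_⟩
    rw [eqn, if_neg hi]
    exact IsHomogeneous.sum _ _ _ fun j _ =>
      (isHomogeneous_prod_X_sub _ _).mul (isHomogeneous_X _ _)

lemma sum_castLE_eq_sum_Iio {M : Type*} [AddCommMonoid M] (g : Fin n → M) :
    ∑ a : Fin k, g (Fin.castLE k.2.le a) = ∑ i ∈ Finset.Iio k, g i := by
  refine Finset.sum_bij (fun a _ => Fin.castLE k.2.le a) (fun a _ => ?_) (fun a _ b _ h => ?_)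
    (fun i hi => ?_) fun _ _ => rfl
  · exact Finset.mem_Iio.2 (Fin.lt_def.2 a.2)
  · exact Fin.castLE_injective _ h
  · exact ⟨⟨i, Fin.lt_def.1 (Finset.mem_Iio.1 hi)⟩, Finset.mem_univ _, rfl⟩

/-- For `i < k` this is Cramer's rule: the combination of the rows of the matrix of `powDet` with
the coefficients `eqn k i` consists of combinations of power sums. -/
lemma eqn_mul_powDet_mem_altAnn (i : Fin n) : eqn k i * powDet k.2.le ∈ altAnn n := by
  classical
  by_cases hi : i < k
  · set M : Matrix (Fin k) (Fin k) (Poly n) :=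
      Matrix.of fun a b => (X (Fin.castLE k.2.le a) : Poly n) ^ ((b : ℕ) + 1) with hM
    set u : Fin k → Poly n := fun a => eqn k (Fin.castLE k.2.le a) with hu
    have hQ : ∀ j : Fin n, j < k →
        (revNodal (Finset.Ici k)).eval (X j) = eqn k j := by
      intro j hj
      have : Finset.Ici k = insert k (Finset.Ioi k) := by
        ext i; simp [le_iff_eq_or_lt]
      rw [eval_revNodal, eqn, if_pos hj, this, Finset.prod_insert (by simp), mul_comm]
    have hvec : ∀ b, Matrix.vecMul u M b ∈ altAnn n := by
      intro b
      have h1 : Matrix.vecMul u M b =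
          ∑ j, (revNodal (Finset.Ici k)).eval (X j) * (X j : Poly n) ^ ((b : ℕ) + 1) := by
        have h2 : Matrix.vecMul u M b =
            ∑ a : Fin k, (fun j => eqn k j * (X j : Poly n) ^ ((b : ℕ) + 1))
              (Fin.castLE k.2.le a) := rfl
        rw [h2, sum_castLE_eq_sum_Iio k fun j => eqn k j * (X j : Poly n) ^ ((b : ℕ) + 1)]
        refine Finset.sum_subset_zero_on_sdiff (Finset.subset_univ _) (fun j hj => ?_)
          fun j hj => ?_
        · have hj' : k ≤ j := by simpa using hj
          rw [eval_revNodal, prod_X_sub_eq_zero (Finset.mem_Ici.2 hj'), zero_mul]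
        · rw [hQ j (Finset.mem_Iio.1 hj)]
      rw [h1, sum_eval_X_mul_pow]
      exact Ideal.sum_mem _ fun r _ => Ideal.mul_mem_left _ _ (psum_mem_altAnn n (r + b))
    have hadj : Matrix.vecMul (Matrix.vecMul u M) M.adjugate = M.det • u := by
      rw [Matrix.vecMul_vecMul, Matrix.mul_adjugate, Matrix.vecMul_smul, Matrix.vecMul_one]
    have h3 := congrFun hadj ⟨i, hi⟩
    have h4 : eqn k i * powDet k.2.le = ∑ b, Matrix.vecMul u M b * M.adjugate b ⟨i, hi⟩ := by
      have h5 : Matrix.vecMul (Matrix.vecMul u M) M.adjugate ⟨i, hi⟩ =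
        ∑ b, Matrix.vecMul u M b * M.adjugate b ⟨i, hi⟩ := rfl
      rw [← h5, h3, mul_comm]
      rfl
    rw [h4]
    exact Ideal.sum_mem _ fun b _ => Ideal.mul_mem_right _ _ (hvec b)
  · refine Ideal.mul_mem_right _ _ ((Ideal.span_le.2 ?_) (eqn_mem_span_psum k hi))
    rintro _ ⟨r, hr, rfl⟩
    obtain ⟨r, rfl⟩ : ∃ r', r = r' + 1 := ⟨r - 1, by have := hr.1; omega⟩
    exact psum_mem_altAnn n r

end System

/-! ### Nonvanishing of the functional on the determinant of the system -/

section Nonvanishing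

open MvPolynomial

variable {n : ℕ} (k : Fin n)

lemma isHomogeneous_powDet_mul_det :
    (powDet k.2.le * (eqnMatrix k).det).IsHomogeneous (n.choose 2) := by
  have h1 : (∏ i ∈ Finset.Iio k, ∏ l ∈ Finset.Ioi k, (X l - X i : Poly n)).IsHomogeneous
      (∑ i ∈ Finset.Iio k, (Finset.Ioi k).card) :=
    IsHomogeneous.prod _ _ _ fun i _ => isHomogeneous_prod_X_sub _ _
  have h2 : (∑ m ∈ Finset.Iic k, ∏ l ∈ Finset.Ioi k, (X l - X m : Poly n)).IsHomogeneous
      (Finset.Ioi k).card :=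
    IsHomogeneous.sum _ _ _ fun i _ => isHomogeneous_prod_X_sub _ _
  have h3 : (∏ i ∈ Finset.Ioi k, ∏ l ∈ Finset.Ioi i, (X l - X i : Poly n)).IsHomogeneous
      (∑ i ∈ Finset.Ioi k, (Finset.Ioi i).card) :=
    IsHomogeneous.prod _ _ _ fun i _ => isHomogeneous_prod_X_sub _ _
  have h := (isHomogeneous_powDet k.2.le).mul ((h1.mul h2).mul h3)
  rw [← det_eqnMatrix] at h
  convert h using 1
  -- both sides count the pairs `i < j` in `Fin n`
  have e1 : n.choose 2 = ∑ i : Fin n, (n - 1 - i) := by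
    rw [Fin.sum_univ_eq_sum_range (fun i => n - 1 - i) n, Finset.sum_range_reflect (fun i => i) n,
      Finset.sum_range_id, Nat.choose_two_right]
  have e2 : ((k : ℕ) + 1).choose 2 = ∑ i ∈ Finset.Iio k, ((k : ℕ) - i) := by
    rw [← sum_castLE_eq_sum_Iio k fun i => (k : ℕ) - i]
    simp only [Fin.val_castLE]
    rw [Fin.sum_univ_eq_sum_range (fun i => (k : ℕ) - i) k, Nat.choose_two_right,
      ← Finset.sum_range_id, ← Finset.sum_range_reflect, Finset.sum_range_succ]
    simp
  have hk := k.2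
  rw [e1, e2, sum_eq_Iio_add_add_Ioi k]
  simp only [Fin.card_Ioi]
  have e3 : ∑ i ∈ Finset.Iio k, (n - 1 - (i : ℕ)) =
      ∑ i ∈ Finset.Iio k, ((k : ℕ) - i) + ∑ i ∈ Finset.Iio k, (n - 1 - (k : ℕ)) := by
    rw [← Finset.sum_add_distrib]
    refine Finset.sum_congr rfl fun i hi => ?_
    have : (i : ℕ) < k := Fin.lt_def.1 (Finset.mem_Iio.1 hi)
    omega
  rw [e3]
  ring

lemma eval_powDet (v : Fin n → ℂ) : eval v (powDet k.2.le) =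
    (∏ i ∈ Finset.Iio k, v i) * ∏ i ∈ Finset.Iio k, ∏ j ∈ Finset.Ioo i k, (v j - v i) := by
  have hpi : ∀ g : Fin n → ℂ, ∏ a : Fin k, g (Fin.castLE k.2.le a) = ∏ i ∈ Finset.Iio k, g i :=
    fun g => sum_castLE_eq_sum_Iio (M := Additive ℂ) k g
  have h1 : eval v (powDet k.2.le) = (Matrix.of fun a b : Fin k =>
      v (Fin.castLE k.2.le a) *
        Matrix.vandermonde (fun a : Fin k => v (Fin.castLE k.2.le a)) a b).det := by
    rw [powDet, RingHom.map_det]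
    congr 1
    ext a b
    simp [Matrix.vandermonde_apply, pow_succ']
  rw [h1, Matrix.det_mul_column, Matrix.det_vandermonde, hpi,
    ← hpi fun i => ∏ j ∈ Finset.Ioo i k, (v j - v i)]
  congr 1
  refine Finset.prod_congr rfl fun a _ => ?_
  refine Finset.prod_bij (fun b _ => Fin.castLE k.2.le b) (fun b hb => ?_) (fun a _ b _ h => ?_)
    (fun i hi => ?_) fun _ _ => rfl
  · rw [Finset.mem_Ioi] at hb
    exact Finset.mem_Ioo.2 ⟨hb, Fin.lt_def.2 b.2⟩
  · exact Fin.castLE_injective _ h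
  · rw [Finset.mem_Ioo] at hi
    exact ⟨⟨i, Fin.lt_def.1 hi.2⟩, Finset.mem_Ioi.2 hi.1, rfl⟩

/-- The factors of `powDet` and of the triangular determinant make up all pairs `i < j` except
those containing `k`; with the differences of the latter they give the Vandermonde determinant. -/
lemma eval_powDet_mul_det (v : Fin n → ℂ) :
    eval v (powDet k.2.le * (eqnMatrix k).det) * v k *
      ((∏ i ∈ Finset.Iio k, (v k - v i)) * ∏ j ∈ Finset.Ioi k, (v j - v k)) =
    subsetSum v (Finset.Iic k) * (Matrix.vandermonde v).det := by
  have hIic : ∏ i ∈ Finset.Iic k, v i = (∏ i ∈ Finset.Iio k, v i) * v k :=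
    sum_Iic_eq (M := Additive ℂ) k v
  have hc : (Finset.Iic k)ᶜ = Finset.Ioi k := by
    ext i; simp
  have hs : ∑ m ∈ Finset.Iic k, ∏ l ∈ Finset.Ioi k, (v l - v m) =
      ∑ m, ∏ l ∈ Finset.Ioi k, (v l - v m) :=
    Finset.sum_subset (Finset.subset_univ _) fun m _ hm =>
      Finset.prod_eq_zero (Finset.mem_Ioi.2 (by simpa using hm)) (sub_self _)
  have hV : (Matrix.vandermonde v).det =
      ((∏ i ∈ Finset.Iio k, ∏ j ∈ Finset.Ioo i k, (v j - v i)) * (∏ i ∈ Finset.Iio k, (v k - v i)) *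
        ∏ i ∈ Finset.Iio k, ∏ j ∈ Finset.Ioi k, (v j - v i)) *
      (∏ j ∈ Finset.Ioi k, (v j - v k)) * ∏ i ∈ Finset.Ioi k, ∏ j ∈ Finset.Ioi i, (v j - v i) := by
    rw [Matrix.det_vandermonde, prod_eq_Iio_mul_mul_Ioi k]
    congr 2
    rw [← Finset.prod_mul_distrib, ← Finset.prod_mul_distrib]
    refine Finset.prod_congr rfl fun i hi => ?_
    rw [Finset.mem_Iio] at hi
    have h1 : Finset.Ioi i = insert k (Finset.Ioo i k) ∪ Finset.Ioi k := by
      ext j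
      simp only [Finset.mem_Ioi, Finset.mem_union, Finset.mem_insert, Finset.mem_Ioo]
      omega
    have hd : Disjoint (insert k (Finset.Ioo i k)) (Finset.Ioi k) := by
      rw [Finset.disjoint_left]
      intro j hj hj'
      simp only [Finset.mem_Ioi, Finset.mem_insert, Finset.mem_Ioo] at hj hj'
      omega
    rw [h1, Finset.prod_union hd, Finset.prod_insert (by simp)]
    ring
  rw [map_mul, eval_powDet, det_eqnMatrix, hV, subsetSum, hIic, hc, ← hs]
  simp only [map_mul, map_prod, map_sum, map_sub, eval_X]
  ring

/-- The nonvanishing that makes the Bézoutian criterion applicable: by evaluation at the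
`n`-th roots of unity it reduces to a sum over subsets. -/
lemma altCoeff_powDet_mul_det_ne_zero : altCoeff n ℂ (powDet k.2.le * (eqnMatrix k).det) ≠ 0 := by
  classical
  intro h0
  have hsum := sum_sign_eval_eq (isHomogeneous_powDet_mul_det k) (rootEnum n)
  rw [h0, zero_mul] at hsum
  set ρ : ℂ := (-1) ^ (Finset.Ioi k).card * n with hρ
  have hterm : ∀ w : Equiv.Perm (Fin n),
      eval (rootEnum n ∘ w) (powDet k.2.le * (eqnMatrix k).det) * ρ =
      subsetSum (rootEnum n ∘ w) (Finset.Iic k) *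
        ((Equiv.Perm.sign w : ℤ) * (Matrix.vandermonde (rootEnum n)).det) := by
    intro w
    have h1 := eval_powDet_mul_det k (rootEnum n ∘ w)
    have h2 : (Matrix.vandermonde (rootEnum n ∘ w)).det =
        (Equiv.Perm.sign w : ℤ) * (Matrix.vandermonde (rootEnum n)).det :=
      Matrix.det_permute w (Matrix.vandermonde (rootEnum n))
    rw [h2] at h1
    rw [← h1, hρ, ← rootEnum_mul_prod_sub k w]
    have h3 : Finset.univ.erase k = Finset.Iio k ∪ Finset.Ioi k := by
      ext j
      simp [lt_or_lt_iff_ne]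
    have hd : Disjoint (Finset.Iio k) (Finset.Ioi k) := by
      rw [Finset.disjoint_left]
      intro j hj hj'
      simp only [Finset.mem_Ioi, Finset.mem_Iio] at hj hj'
      omega
    rw [h3, Finset.prod_union hd]
    have h4 : ∏ j ∈ Finset.Ioi k, ((rootEnum n ∘ w) j - (rootEnum n ∘ w) k) =
        (-1) ^ (Finset.Ioi k).card *
          ∏ j ∈ Finset.Ioi k, (rootEnum n (w k) - rootEnum n (w j)) := by
      rw [← Finset.prod_const, ← Finset.prod_mul_distrib]
      refine Finset.prod_congr rfl fun j _ => ?_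
      simp only [Function.comp_apply]
      ring
    rw [h4]
    simp only [Function.comp_apply]
    ring
  have hV : (Matrix.vandermonde (rootEnum n)).det ≠ 0 :=
    Matrix.det_vandermonde_ne_zero_iff.2 (rootEnum_injective n)
  have hz : (∑ w : Equiv.Perm (Fin n), subsetSum (rootEnum n ∘ w) (Finset.Iic k)) *
      (Matrix.vandermonde (rootEnum n)).det = 0 := by
    rw [Finset.sum_mul]
    have h5 := congrArg (fun z => z * ρ) hsum
    simp only [zero_mul, Finset.sum_mul] at h5
    rw [← h5]
    refine Finset.sum_congr rfl fun w _ => ?_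
    rw [smul_mul_assoc, hterm w, zsmul_eq_mul]
    have h6 : (((Equiv.Perm.sign w : ℤˣ) : ℤ) : ℂ) * (((Equiv.Perm.sign w : ℤˣ) : ℤ) : ℂ) = 1 := by
      rw [← Int.cast_mul, Int.units_coe_mul_self, Int.cast_one]
    linear_combination (-(subsetSum (rootEnum n ∘ w) (Finset.Iic k) *
      (Matrix.vandermonde (rootEnum n)).det)) * h6
  rcases mul_eq_zero.1 hz with h | h
  · exact sum_perm_subsetSum_rootEnum_ne_zero ⟨k, by simp⟩ h
  · exact hV h

/-- A homogeneous polynomial of degree above `n.choose 2 - (k + 1).choose 2` is a combination of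
the equations `eqn k`. -/
theorem mem_span_range_eqn {f : Poly n} {d : ℕ} (hf : f.IsHomogeneous d)
    (hd : n.choose 2 < d + ((k : ℕ) + 1).choose 2) :
    f ∈ Ideal.span (Set.range (eqn k)) := by
  obtain ⟨U, hU⟩ := exists_X_eq_sum_coord k
  refine mem_span_range_of_altCoeff_det_ne_zero (isHomogeneous_eqn k) (eqn_eq_mulVec k) hU
    (fun j => ?_) (eqn_mul_powDet_mem_altAnn k) (altCoeff_powDet_mul_det_ne_zero k)
    (isHomogeneous_powDet k.2.le) hf hd
  unfold coord
  split_ifs <;> simp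

end Nonvanishing

/-! ### Vanishing of forms of large degree -/

section Vanishing

open MvPolynomial

variable {n : ℕ}

lemma partialD_psum (i : Fin n) (r : ℕ) :
    partialD i (psum (Fin n) ℂ (r + 1)) = C ((r : ℂ) + 1) * X i ^ r := by
  classical
  simp only [partialD, Derivation.coeFn_coe, psum, map_sum, pderiv_pow, pderiv_X]
  rw [Finset.sum_eq_single i]
  · simp
  · intro j _ hj
    simp [hj]
  · simp

lemma sum_eval_tmul_dx_mem_invIdeal {Q : Polynomial (Poly n)} (hQ : Q.natDegree < n) :
    ∑ j, Q.eval (X j : Poly n) ⊗ₜ[ℂ] dx j ∈ invIdeal n := by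
  have h : ∑ j, Q.eval (X j : Poly n) ⊗ₜ[ℂ] dx j =
      ∑ r ∈ Finset.range (Q.natDegree + 1),
        ((C ((r : ℂ) + 1)⁻¹ * Q.coeff r) ⊗ₜ[ℂ] (1 : Grass n)) * dPowerSum n (r + 1) := by
    simp only [Polynomial.eval_eq_sum_range, TensorProduct.sum_tmul, dPowerSum, Finset.mul_sum,
      Algebra.TensorProduct.tmul_mul_tmul, one_mul, partialD_psum]
    rw [Finset.sum_comm]
    refine Finset.sum_congr rfl fun r _ => Finset.sum_congr rfl fun j _ => ?_
    have h1 : (C ((r : ℂ) + 1)⁻¹ : Poly n) * C ((r : ℂ) + 1) = 1 := by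
      rw [← C_mul, inv_mul_cancel₀ (by exact_mod_cast r.succ_ne_zero), C_1]
    congr 1
    linear_combination (-(Q.coeff r * X j ^ r)) * h1
  rw [h]
  refine sum_mem fun r hr => (invIdeal n).mul_mem_left _ _ ?_
  rw [Finset.mem_range] at hr
  exact TwoSidedIdeal.subset_span (Or.inr ⟨r + 1, ⟨by omega, by omega⟩, rfl⟩)

/-- The ideal of the polynomials `f` such that `f dx_I` vanishes modulo `invIdeal`. -/
def coeffIdeal {k : ℕ} (I : Fin k ↪o Fin n) : Ideal (Poly n) where
  carrier := {f | f ⊗ₜ[ℂ] dxWedge I ∈ invIdeal n}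
  zero_mem' := by
    rw [Set.mem_ofPred_eq, TensorProduct.zero_tmul]
    exact (invIdeal n).zero_mem
  add_mem' hf hg := by
    rw [Set.mem_ofPred_eq, TensorProduct.add_tmul]
    exact (invIdeal n).add_mem hf hg
  smul_mem' c f hf := by
    have h : (c • f) ⊗ₜ[ℂ] dxWedge I = (c ⊗ₜ[ℂ] (1 : Grass n)) * (f ⊗ₜ[ℂ] dxWedge I) := by
      rw [Algebra.TensorProduct.tmul_mul_tmul, one_mul, smul_eq_mul]
    rw [Set.mem_ofPred_eq, h]
    exact (invIdeal n).mul_mem_left _ _ hf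

lemma mem_coeffIdeal {k : ℕ} {I : Fin k ↪o Fin n} {f : Poly n} :
    f ∈ coeffIdeal I ↔ f ⊗ₜ[ℂ] dxWedge I ∈ invIdeal n := Iff.rfl

lemma psum_mem_coeffIdeal {k : ℕ} (I : Fin k ↪o Fin n) {r : ℕ} (hr : r ∈ Set.Icc 1 n) :
    psum (Fin n) ℂ r ∈ coeffIdeal I := by
  have h : psum (Fin n) ℂ r ⊗ₜ[ℂ] dxWedge I = powerSum n r * (1 ⊗ₜ[ℂ] dxWedge I) := by
    rw [powerSum, Algebra.TensorProduct.tmul_mul_tmul, one_mul, mul_one]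
  rw [mem_coeffIdeal, h]
  exact (invIdeal n).mul_mem_right _ _ (TwoSidedIdeal.subset_span (Or.inl ⟨r, hr, rfl⟩))

/-- Modulo the ideal, `∑_j Q(x_j) dx_j = 0` for polynomials `Q` of degree less than `n`. Choose `Q`
to vanish at the `x_j` with `j` outside `I`, and put this sum in place of a factor `dx_i` of
`dx_I`: all the summands except that for `j = i` vanish. -/
lemma prod_compl_mem_coeffIdeal {k : ℕ} (I : Fin k ↪o Fin n) (a : Fin k) :
    ∏ j ∈ (Finset.univ.map I.toEmbedding)ᶜ, (X j - X (I a) : Poly n) ∈ coeffIdeal I := by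
  classical
  set s := (Finset.univ.map I.toEmbedding)ᶜ with hs
  set Q := revNodal s with hQdef
  have hkn : k ≤ n := by simpa using Fintype.card_le_of_injective _ I.injective
  have hQ : Q.natDegree < n := by
    refine (natDegree_revNodal_le s).trans_lt ?_
    rw [hs, Finset.card_compl, Finset.card_map]
    simp only [Finset.card_univ, Fintype.card_fin]
    have := a.pos
    omega
  set L := List.ofFn fun r : Fin k => dx (I r) with hL
  have hlen : (a : ℕ) < L.length := by simp [hL]
  have hmul : ∀ w : Grass n, (L.set a w).prod =
      (L.take a).prod * w * (L.drop (a + 1)).prod := by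
    intro w
    rw [List.prod_set, if_pos hlen]
  have hset : ∀ j : Fin n, (L.set a (dx j)).prod = ExteriorAlgebra.ιMulti ℂ k
      (Function.update (fun r => Pi.single (I r) (1 : ℂ)) a (Pi.single j 1)) := by
    intro j
    rw [ExteriorAlgebra.ιMulti_apply]
    congr 1
    apply List.ext_getElem
    · simp [hL]
    · intro i h1 h2
      rw [List.getElem_set]
      by_cases hia : (a : ℕ) = i
      · subst hia
        simp [dx]
      · have hne : (⟨i, by simpa [hL] using h1⟩ : Fin k) ≠ a := fun h => hia (by rw [← h])
        simp [hia, hL, dx, Function.update_of_ne hne]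
  have hmem : ∑ j, Q.eval (X j : Poly n) ⊗ₜ[ℂ] (L.set a (dx j)).prod ∈ invIdeal n := by
    have h := (invIdeal n).mul_mem_right _ (1 ⊗ₜ[ℂ] (L.drop (a + 1)).prod)
      ((invIdeal n).mul_mem_left (1 ⊗ₜ[ℂ] (L.take a).prod) _ (sum_eval_tmul_dx_mem_invIdeal hQ))
    convert h using 1
    rw [Finset.mul_sum, Finset.sum_mul]
    refine Finset.sum_congr rfl fun j _ => ?_
    rw [Algebra.TensorProduct.tmul_mul_tmul, Algebra.TensorProduct.tmul_mul_tmul, one_mul, mul_one,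
      hmul]
  rw [Finset.sum_eq_single (I a)] at hmem
  · have hself : (L.set a (dx (I a))).prod = dxWedge I := by
      rw [hset, Function.update_eq_self_iff.2 rfl, ExteriorAlgebra.ιMulti_apply]
      rfl
    rw [hself, hQdef, eval_revNodal] at hmem
    exact hmem
  · intro j _ hj
    by_cases hjs : j ∈ s
    · rw [hQdef, eval_revNodal, prod_X_sub_eq_zero hjs, TensorProduct.zero_tmul]
    · obtain ⟨b, rfl⟩ : ∃ b, I b = j := by simpa [hs] using hjs
      have hba : b ≠ a := fun h => hj (by rw [h])
      rw [hset, AlternatingMap.map_eq_zero_of_eq _ _ _ hba, TensorProduct.tmul_zero]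
      rw [Function.update_of_ne hba, Function.update_self]
  · simp

lemma mem_coeffIdeal_of_isHomogeneous {k : ℕ} (I : Fin k ↪o Fin n) {f : Poly n} {l : ℕ}
    (hf : f.IsHomogeneous l) (hl : n.choose 2 < l + (k + 1).choose 2) : f ∈ coeffIdeal I := by
  classical
  have hkn : k ≤ n := by simpa using Fintype.card_le_of_injective _ I.injective
  rcases hkn.lt_or_eq with hlt | rfl
  · set K : Fin n := ⟨k, hlt⟩ with hK
    obtain ⟨σ, hσ⟩ : ∃ σ : Equiv.Perm (Fin n), ∀ a : Fin k, σ (Fin.castLE hkn a) = I a := by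
      obtain ⟨σ, hσ⟩ := (Equiv.Perm.isMultiplyPretransitive (Fin n) k).exists_smul_eq
        ((Fin.castLEEmb hkn)) I.toEmbedding
      exact ⟨σ, fun a => DFunLike.congr_fun hσ a⟩
    have hmem := mem_span_range_eqn K (hf.rename_isHomogeneous (f := σ.symm)) hl
    have hle : Ideal.span (Set.range (eqn K)) ≤
        (coeffIdeal I).comap (rename σ : Poly n →ₐ[ℂ] Poly n) := by
      rw [Ideal.span_le]
      rintro _ ⟨i, rfl⟩
      rw [SetLike.mem_coe, Ideal.mem_comap]
      by_cases hi : i < K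
      · have h := prod_compl_mem_coeffIdeal I ⟨i, hi⟩
        convert h using 1
        have hc : (Finset.univ.map I.toEmbedding)ᶜ = (Finset.Ici K).map σ.toEmbedding := by
          ext x
          obtain ⟨x, rfl⟩ := σ.surjective x
          simp only [Finset.mem_compl, Finset.mem_map, Finset.mem_univ, true_and, Finset.mem_Ici,
            Equiv.coe_toEmbedding, σ.injective.eq_iff, exists_eq_right,
            RelEmbedding.coe_toEmbedding,
            ← hσ]
          constructor
          · intro hx
            by_contra hx'
            exact hx ⟨⟨x, Fin.lt_def.1 (not_le.1 hx')⟩, rfl⟩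
          · rintro hx ⟨b, rfl⟩
            exact absurd (Fin.le_def.1 hx) (by simp [hK])
        have hIci : Finset.Ici K = insert K (Finset.Ioi K) := by
          ext i; simp [le_iff_eq_or_lt]
        rw [hc, Finset.prod_map, ← hσ, hIci, Finset.prod_insert (by simp), eqn, if_pos hi,
          mul_comm]
        simp only [map_mul, map_prod, map_sub, rename_X, Equiv.coe_toEmbedding]
        rfl
      · have h2 : Ideal.span ((fun r => psum (Fin n) ℂ r) '' Set.Icc 1 n) ≤
            (coeffIdeal I).comap (rename σ : Poly n →ₐ[ℂ] Poly n) := by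
          rw [Ideal.span_le]
          rintro _ ⟨r, hr, rfl⟩
          rw [SetLike.mem_coe, Ideal.mem_comap]
          have h3 : (rename σ : Poly n →ₐ[ℂ] Poly n) (psum (Fin n) ℂ r) = psum (Fin n) ℂ r :=
            rename_psum _ _ _ σ
          rw [h3]
          exact psum_mem_coeffIdeal I hr
        exact h2 (eqn_mem_span_psum K hi)
    have h := hle hmem
    rw [Ideal.mem_comap] at h
    simpa [rename_rename] using h
  · rcases Nat.eq_zero_or_pos k with rfl | hk
    · have hf0 : f = 0 := by
        rw [eq_C_of_isEmpty f] at hf ⊢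
        by_contra h0
        have := hf.totalDegree h0
        rw [totalDegree_C] at this
        simp at hl
        omega
      rw [hf0]
      exact (coeffIdeal I).zero_mem
    · have h := prod_compl_mem_coeffIdeal I ⟨0, hk⟩
      have hs : (Finset.univ.map I.toEmbedding)ᶜ = ∅ := by
        rw [Finset.compl_eq_empty_iff, ← Finset.card_eq_iff_eq_univ, Finset.card_map]
        rfl
      rw [hs, Finset.prod_empty] at h
      rw [(Ideal.eq_top_iff_one _).2 h]
      trivial

theorem mem_invIdeal_of_mem_homForms {l k : ℕ} {ω : Omega n} (hω : ω ∈ homForms n l k)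
    (hl : (l : ℤ) > (n.choose 2 : ℤ) - ((k + 1).choose 2 : ℤ)) : ω ∈ invIdeal n := by
  obtain ⟨f, hf, rfl⟩ := hω
  refine sum_mem fun I _ => ?_
  exact mem_coeffIdeal.1 (mem_coeffIdeal_of_isHomogeneous I (hf I) (by omega))

end Vanishing

/-! ### A functional on forms that separates the ideal -/

section Separation

open MvPolynomial

variable {n : ℕ}

/-- The determinant as an alternating function of the rows, linear over a smaller base ring. -/
noncomputable def detAlternating (R A : Type*) [CommRing R] [CommRing A] [Algebra R A] (k : ℕ) :
    (Fin k → A) [⋀^Fin k]→ₗ[R] A :=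
  { (Matrix.detRowAlternating (R := A) (n := Fin k)).toMultilinearMap.restrictScalars R with
    map_eq_zero_of_eq' := fun v _ _ h hij =>
      (Matrix.detRowAlternating (R := A) (n := Fin k)).map_eq_zero_of_eq v h hij }

/-- The linear map `v ↦ (∑_l v(l) x_l ^ (b + 1))_{b < k}`. -/
noncomputable def powMap (n k : ℕ) : (Fin n → ℂ) →ₗ[ℂ] (Fin k → Poly n) :=
  LinearMap.pi fun b : Fin k =>
    ∑ l : Fin n, (LinearMap.proj l : (Fin n → ℂ) →ₗ[ℂ] ℂ).smulRight (X l ^ ((b : ℕ) + 1))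

/-- The alternating form `(v_0, …, v_{k-1}) ↦ det (∑_l v_a(l) x_l ^ (b + 1))_{a, b < k}`, so that
`(e_{i_a})_a ↦ det (x_{i_a} ^ (b + 1))`. -/
noncomputable def detForm (n k : ℕ) : (Fin n → ℂ) [⋀^Fin k]→ₗ[ℂ] Poly n :=
  (detAlternating ℂ (Poly n) k).compLinearMap (powMap n k)

lemma detForm_apply {k : ℕ} (v : Fin k → Fin n → ℂ) : detForm n k v =
    (Matrix.of fun a b : Fin k => ∑ l, v a l • (X l : Poly n) ^ ((b : ℕ) + 1)).det := by
  have h : detForm n k v = Matrix.det fun a => powMap n k (v a) := rfl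
  rw [h]
  congr 1
  funext a b
  simp [powMap]

/-- The linear map `f dx_{i_1} ⋯ dx_{i_k} ↦ f det (x_{i_a} ^ b)_{1 ≤ a, b ≤ k}` on forms. -/
noncomputable def formDet (n : ℕ) : Omega n →ₗ[ℂ] Poly n :=
  TensorProduct.lift ((LinearMap.mul ℂ (Poly n)).compl₂
    (ExteriorAlgebra.liftAlternating (detForm n)))

lemma formDet_tmul (f : Poly n) (g : Grass n) :
    formDet n (f ⊗ₜ g) = f * ExteriorAlgebra.liftAlternating (detForm n) g := by
  simp [formDet]

lemma formDet_tmul_one_mul (f : Poly n) (α : Omega n) :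
    formDet n ((f ⊗ₜ (1 : Grass n)) * α) = f * formDet n α := by
  induction α using TensorProduct.induction_on with
  | zero => simp
  | tmul p g =>
    rw [Algebra.TensorProduct.tmul_mul_tmul, one_mul, formDet_tmul, formDet_tmul, mul_assoc]
  | add α β hα hβ => rw [mul_add, map_add, hα, hβ, map_add, mul_add]

/-- Expanding the determinant along the row of the new factor, `∑_i x_i ^ r dx_i` contributes
power sums. -/
lemma sum_pow_mul_liftAlternating_mem_altAnn (r : ℕ) (g : Grass n) :
    ∑ i, X i ^ r * ExteriorAlgebra.liftAlternating (detForm n) (dx i * g) ∈ altAnn n := by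
  have hg : g ∈ Submodule.span ℂ (Set.range fun x : Σ m, (Fin m → Fin n → ℂ) =>
      ExteriorAlgebra.ιMulti ℂ x.1 x.2) := by
    rw [ExteriorAlgebra.ιMulti_span]
    trivial
  induction hg using Submodule.span_induction with
  | zero => simp
  | add g g' _ _ ih ih' =>
    simp only [mul_add, map_add, Finset.sum_add_distrib]
    exact Ideal.add_mem _ ih ih'
  | smul c g _ ih =>
    simp only [mul_smul_comm, map_smul, ← Finset.smul_sum]
    rw [MvPolynomial.smul_eq_C_mul]
    exact Ideal.mul_mem_left _ _ ih
  | mem g hg =>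
    obtain ⟨⟨m, v⟩, rfl⟩ := hg
    have h1 : ∀ i : Fin n, dx i * ExteriorAlgebra.ιMulti ℂ m v =
        ExteriorAlgebra.ιMulti ℂ (m + 1)
          (Fin.cons (Pi.single i 1) v : Fin (m + 1) → Fin n → ℂ) := by
      intro i
      rw [ExteriorAlgebra.ιMulti_succ_apply]
      rfl
    have h2 : ∀ i : Fin n, ExteriorAlgebra.liftAlternating (detForm n)
        (dx i * ExteriorAlgebra.ιMulti ℂ m v) = ∑ j : Fin (m + 1), (-1) ^ (j : ℕ) *
          (X i ^ ((j : ℕ) + 1)) * ((Matrix.of fun (a : Fin m) (b : Fin (m + 1)) =>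
            ∑ l, v a l • (X l : Poly n) ^ ((b : ℕ) + 1)).submatrix id j.succAbove).det := by
      intro i
      rw [h1, ExteriorAlgebra.liftAlternating_apply_ιMulti, detForm_apply,
        Matrix.det_succ_row_zero]
      refine Finset.sum_congr rfl fun j _ => ?_
      congr 1
      congr 1
      simp [Pi.single_apply]
    simp only [h2, Finset.mul_sum]
    rw [Finset.sum_comm]
    refine Ideal.sum_mem _ fun j _ => ?_
    have h3 := Ideal.mul_mem_right ((-1) ^ (j : ℕ) * ((Matrix.of fun (a : Fin m)
      (b : Fin (m + 1)) => ∑ l, v a l • (X l : Poly n) ^ ((b : ℕ) + 1)).submatrix id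
        j.succAbove).det) _ (psum_mem_altAnn n (r + j))
    convert h3 using 1
    rw [psum, Finset.sum_mul]
    refine Finset.sum_congr rfl fun i _ => ?_
    ring

lemma formDet_dPowerSum_mul_mem_altAnn (r : ℕ) (α : Omega n) :
    formDet n (dPowerSum n (r + 1) * α) ∈ altAnn n := by
  induction α using TensorProduct.induction_on with
  | zero => simp
  | add α β hα hβ =>
    rw [mul_add, map_add]
    exact Ideal.add_mem _ hα hβ
  | tmul f g =>
    have h := Ideal.mul_mem_left _ (C ((r : ℂ) + 1) * f)
      (sum_pow_mul_liftAlternating_mem_altAnn r g)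
    convert h using 1
    rw [dPowerSum, Finset.sum_mul, map_sum, Finset.mul_sum]
    refine Finset.sum_congr rfl fun i _ => ?_
    rw [Algebra.TensorProduct.tmul_mul_tmul, formDet_tmul, partialD_psum]
    ring

/-- Supercommutativity of the Grassmann algebra: vectors can be moved to the left. -/
lemma exists_mul_ι_eq_ι_mul (g : Grass n) :
    ∃ g' : Grass n, ∀ v, g * ExteriorAlgebra.ι ℂ v = ExteriorAlgebra.ι ℂ v * g' := by
  induction g using ExteriorAlgebra.induction with
  | algebraMap c => exact ⟨algebraMap ℂ _ c, fun v => Algebra.commutes c _⟩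
  | ι x => exact ⟨-ExteriorAlgebra.ι ℂ x, fun v => by
      rw [mul_neg]; exact eq_neg_of_add_eq_zero_left (ExteriorAlgebra.ι_add_mul_swap x v)⟩
  | mul a b ha hb =>
    obtain ⟨a', ha⟩ := ha
    obtain ⟨b', hb⟩ := hb
    exact ⟨a' * b', fun v => by rw [mul_assoc, hb, ← mul_assoc, ha, mul_assoc]⟩
  | add a b ha hb =>
    obtain ⟨a', ha⟩ := ha
    obtain ⟨b', hb⟩ := hb
    exact ⟨a' + b', fun v => by rw [add_mul, ha, hb, mul_add]⟩

lemma exists_mul_dPowerSum_eq (α : Omega n) :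
    ∃ α' : Omega n, ∀ r, α * dPowerSum n r = dPowerSum n r * α' := by
  induction α using TensorProduct.induction_on with
  | zero => exact ⟨0, fun r => by rw [zero_mul, mul_zero]⟩
  | add α β hα hβ =>
    obtain ⟨α', hα⟩ := hα
    obtain ⟨β', hβ⟩ := hβ
    exact ⟨α' + β', fun r => by rw [add_mul, hα, hβ, mul_add]⟩
  | tmul f g =>
    obtain ⟨g', hg⟩ := exists_mul_ι_eq_ι_mul g
    refine ⟨f ⊗ₜ g', fun r => ?_⟩
    rw [dPowerSum, Finset.mul_sum, Finset.sum_mul]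
    refine Finset.sum_congr rfl fun i _ => ?_
    rw [Algebra.TensorProduct.tmul_mul_tmul, Algebra.TensorProduct.tmul_mul_tmul, mul_comm f, dx,
      hg]

/-- The map `formDet` takes the ideal to polynomials killed by the alternant functional. -/
theorem formDet_mem_altAnn {ω : Omega n} (hω : ω ∈ invIdeal n) : formDet n ω ∈ altAnn n := by
  set J : TwoSidedIdeal (Omega n) := TwoSidedIdeal.mk'
    {β | ∀ α γ, formDet n (α * β * γ) ∈ altAnn n}
    (fun α γ => by simp)
    (fun {x y} hx hy α γ => by
      rw [mul_add, add_mul, map_add]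
      exact Ideal.add_mem _ (hx α γ) (hy α γ))
    (fun {x} hx α γ => by
      have h : formDet n (α * -x * γ) = -formDet n (α * x * γ) := by
        rw [← map_neg]
        congr 1
        exact (congrArg (· * γ) (mul_neg α x)).trans (neg_mul _ _)
      rw [h]
      exact neg_mem (hx α γ))
    (fun {x y} hy α γ => by
      rw [← mul_assoc]
      exact hy _ _)
    (fun {x y} hx α γ => by
      have h := hx α (y * γ)
      rwa [← mul_assoc, mul_assoc α x y] at h) with hJ
  have hle : invIdeal n ≤ J := by
    rw [invIdeal, TwoSidedIdeal.span_le]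
    rintro _ (⟨r, hr, rfl⟩ | ⟨r, hr, rfl⟩)
    · rw [SetLike.mem_coe, hJ, TwoSidedIdeal.mem_mk']
      intro α γ
      have hcomm : α * powerSum n r = powerSum n r * α := by
        induction α using TensorProduct.induction_on with
        | zero => rw [zero_mul, mul_zero]
        | tmul f g =>
          rw [powerSum, Algebra.TensorProduct.tmul_mul_tmul, Algebra.TensorProduct.tmul_mul_tmul,
            mul_one, one_mul, mul_comm]
        | add α β hα hβ => rw [add_mul, hα, hβ, mul_add]
      obtain ⟨r, rfl⟩ : ∃ r', r = r' + 1 := ⟨r - 1, by have := hr.1; omega⟩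
      rw [hcomm, mul_assoc, powerSum, formDet_tmul_one_mul]
      exact Ideal.mul_mem_right _ _ (psum_mem_altAnn n r)
    · rw [SetLike.mem_coe, hJ, TwoSidedIdeal.mem_mk']
      intro α γ
      obtain ⟨α', hα⟩ := exists_mul_dPowerSum_eq α
      obtain ⟨r, rfl⟩ : ∃ r', r = r' + 1 := ⟨r - 1, by have := hr.1; omega⟩
      rw [hα, mul_assoc]
      exact formDet_dPowerSum_mul_mem_altAnn r _
  have h := hle hω
  rw [hJ, TwoSidedIdeal.mem_mk'] at h
  simpa using h 1 1

end Separation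

/-! ### The forms `d_{e_1} ⋯ d_{e_k} h` -/

section Derivatives

open MvPolynomial

variable {n : ℕ}

/-- The product `dx_{i_0} ∧ ⋯ ∧ dx_{i_{k-1}}` for an arbitrary sequence of indices. -/
noncomputable def wedgeSeq {k : ℕ} (i : Fin k → Fin n) : Grass n :=
  ExteriorAlgebra.ιMulti ℂ k fun a => Pi.single (i a) 1

/-- The iterated partial derivative `∂_{i_0} ^ {e_0} ⋯ ∂_{i_{k-1}} ^ {e_{k-1}}`. -/
noncomputable def iterPartial {k : ℕ} (i : Fin k → Fin n) (e : Fin k → ℕ) : Module.End ℂ (Poly n) :=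
  (List.ofFn fun a => partialD (i a) ^ e a).prod

lemma iterPartial_succ {k : ℕ} (i : Fin (k + 1) → Fin n) (e : Fin (k + 1) → ℕ) (h : Poly n) :
    iterPartial i e h = (partialD (i 0) ^ e 0) (iterPartial (Fin.tail i) (Fin.tail e) h) := by
  rw [iterPartial, List.ofFn_succ, List.prod_cons, Module.End.mul_apply]
  rfl

lemma prod_dOp_apply {k : ℕ} (e : Fin k → ℕ) (h : Poly n) :
    (List.ofFn fun a => dOp n (e a)).prod (h ⊗ₜ (1 : Grass n)) =
      ∑ i : Fin k → Fin n, iterPartial i e h ⊗ₜ wedgeSeq i := by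
  induction k with
  | zero => simp [iterPartial, wedgeSeq]
  | succ k ih =>
    rw [List.ofFn_succ, List.prod_cons, Module.End.mul_apply, ih, map_sum,
      ← (Fin.consEquiv fun _ => Fin n).sum_comp, Fintype.sum_prod_type, Finset.sum_comm]
    refine Finset.sum_congr rfl fun i _ => ?_
    rw [dOp, LinearMap.sum_apply]
    refine Finset.sum_congr rfl fun j _ => ?_
    rw [TensorProduct.map_tmul, iterPartial_succ, wedgeSeq, wedgeSeq,
      ExteriorAlgebra.ιMulti_succ_apply]
    rfl

lemma isHomogeneous_partialD_pow {d : ℕ} {f : Poly n} (hf : f.IsHomogeneous d) (i : Fin n)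
    (m : ℕ) : ((partialD i ^ m) f).IsHomogeneous (d - m) := by
  induction m with
  | zero => simpa using hf
  | succ m ih =>
    rw [pow_succ', Module.End.mul_apply, ← Nat.sub_sub]
    exact ih.pderiv

lemma isHomogeneous_iterPartial {k d : ℕ} {f : Poly n} (hf : f.IsHomogeneous d) (i : Fin k → Fin n)
    (e : Fin k → ℕ) : (iterPartial i e f).IsHomogeneous (d - ∑ a, e a) := by
  induction k with
  | zero => simpa [iterPartial] using hf
  | succ k ih =>
    rw [iterPartial_succ, Fin.sum_univ_succ, add_comm (e 0), ← Nat.sub_sub]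
    exact isHomogeneous_partialD_pow (ih _ _) _ _

lemma tmul_wedgeSeq_mem_homForms {k l : ℕ} {f : Poly n} (hf : f.IsHomogeneous l)
    (i : Fin k → Fin n) : f ⊗ₜ wedgeSeq i ∈ homForms n l k := by
  classical
  by_cases hi : Function.Injective i
  · have hmono : StrictMono (i ∘ Tuple.sort i) :=
      (Tuple.monotone_sort i).strictMono_of_injective (hi.comp (Tuple.sort i).injective)
    set I : Fin k ↪o Fin n := OrderEmbedding.ofStrictMono _ hmono with hI
    have h1 : dxWedge I = Equiv.Perm.sign (Tuple.sort i) • wedgeSeq i := by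
      rw [wedgeSeq, ← AlternatingMap.map_perm, ExteriorAlgebra.ιMulti_apply]
      rfl
    have h2 : f ⊗ₜ wedgeSeq i =
        ((Equiv.Perm.sign (Tuple.sort i) : ℤ) : ℂ) • (f ⊗ₜ[ℂ] dxWedge I) := by
      rw [h1, Units.smul_def, ← Int.cast_smul_eq_zsmul ℂ, TensorProduct.tmul_smul, smul_smul,
        ← Int.cast_mul, Int.units_coe_mul_self, Int.cast_one, one_smul]
    rw [h2]
    refine Submodule.smul_mem _ _ ⟨fun J => if J = I then f else 0, fun J => ?_, ?_⟩
    · dsimp only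
      split_ifs
      · exact hf
      · exact isHomogeneous_zero _ _ _
    · rw [Finset.sum_eq_single I]
      · simp
      · intro J _ hJ
        simp [hJ]
      · simp
  · have h0 : wedgeSeq i = 0 := by
      refine ExteriorAlgebra.ιMulti_eq_zero_of_not_inj fun h => hi fun a b hab => h ?_
      simp only [hab]
    rw [h0, TensorProduct.tmul_zero]
    exact Submodule.zero_mem _

end Derivatives

/-! ### The apolar pairing -/

section Apolar

open MvPolynomial

variable {n : ℕ}

/-- The apolar pairing `⟨f, g⟩ = f(∂) g |_{x = 0} = ∑_a a! f_a g_a` on polynomials. -/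
noncomputable def apolar (n : ℕ) : Poly n →ₗ[ℂ] Poly n →ₗ[ℂ] ℂ :=
  (basisMonomials (Fin n) ℂ).constr ℂ fun a =>
    ((∏ i, (a i).factorial : ℕ) : ℂ) • lcoeff ℂ a

lemma apolar_monomial (a : Fin n →₀ ℕ) (c : ℂ) (g : Poly n) :
    apolar n (monomial a c) g = c * ((∏ i, (a i).factorial : ℕ) * coeff a g) := by
  have h : (monomial a c : Poly n) = c • basisMonomials (Fin n) ℂ a := by
    rw [coe_basisMonomials, smul_monomial, smul_eq_mul, mul_one]
  rw [h, map_smul, apolar, Module.Basis.constr_basis]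
  simp

lemma apolar_X_mul (i : Fin n) (f g : Poly n) :
    apolar n (X i * f) g = apolar n f (partialD i g) := by
  classical
  induction f using MvPolynomial.induction_on' with
  | add p q hp hq => simp only [mul_add, map_add, LinearMap.add_apply, hp, hq]
  | monomial a c =>
    have h1 : (X i * monomial a c : Poly n) = monomial (a + Finsupp.single i 1) c := by
      rw [X, monomial_mul, one_mul, add_comm]
    rw [h1, apolar_monomial, apolar_monomial]
    have h2 : coeff a (partialD i g) = coeff (a + Finsupp.single i 1) g * (a i + 1) :=
      coeff_pderiv g a
    have h3 : ∏ j, ((a + Finsupp.single i 1 : Fin n →₀ ℕ) j).factorial =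
        (a i + 1) * ∏ j, (a j).factorial := by
      rw [← Finset.mul_prod_erase Finset.univ _ (Finset.mem_univ i),
        ← Finset.mul_prod_erase Finset.univ (fun j => (a j).factorial) (Finset.mem_univ i)]
      rw [Finset.prod_congr rfl fun j hj => by
        rw [Finsupp.add_apply, Finsupp.single_eq_of_ne (Finset.ne_of_mem_erase hj), add_zero]]
      rw [Finsupp.add_apply, Finsupp.single_eq_same, Nat.factorial_succ, mul_assoc]
    rw [h2, h3]
    push_cast
    ring

lemma apolar_X_pow_mul (i : Fin n) (m : ℕ) (f g : Poly n) :
    apolar n (X i ^ m * f) g = apolar n f ((partialD i ^ m) g) := by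
  induction m generalizing g with
  | zero => simp
  | succ m ih =>
    rw [pow_succ', mul_assoc, apolar_X_mul, ih, pow_succ, Module.End.mul_apply]

lemma apolar_mul_prod_X_pow {k : ℕ} (i : Fin k → Fin n) (e : Fin k → ℕ) (f g : Poly n) :
    apolar n (f * ∏ a, X (i a) ^ e a) g = apolar n f (iterPartial i e g) := by
  induction k generalizing f with
  | zero => simp [iterPartial]
  | succ k ih =>
    rw [Fin.prod_univ_succ, iterPartial_succ, ← apolar_X_pow_mul, ← mul_assoc]
    have h := ih (Fin.tail i) (Fin.tail e) (X (i 0) ^ e 0 * f)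
    rw [mul_comm f]
    exact h

/-- Up to the factor `0! 1! ⋯ (n - 1)!`, the alternant functional is the pairing with the
Vandermonde polynomial. -/
lemma apolar_det_vandermonde (f : Poly n) :
    apolar n f (Matrix.vandermonde (X : Fin n → Poly n)).det =
      ((∏ i : Fin n, (i : ℕ).factorial : ℕ) : ℂ) * altCoeff n ℂ f := by
  classical
  induction f using MvPolynomial.induction_on' with
  | add p q hp hq => simp only [map_add, LinearMap.add_apply, hp, hq, mul_add]
  | monomial b c =>
    have hV : (Matrix.vandermonde (X : Fin n → Poly n)).det =
        ∑ w : Equiv.Perm (Fin n), (Equiv.Perm.sign w : ℤ) • monomial (permExp w) (1 : ℂ) := by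
      rw [Matrix.det_apply, ← Equiv.sum_comp (Equiv.inv (Equiv.Perm (Fin n)))]
      refine Finset.sum_congr rfl fun w _ => ?_
      rw [Equiv.inv_apply, Equiv.Perm.sign_inv, Units.smul_def]
      congr 1
      rw [monomial_eq, C_1, one_mul, Finsupp.prod_fintype _ _ (by simp), ← Equiv.prod_comp w]
      refine Finset.prod_congr rfl fun i _ => ?_
      simp [Matrix.vandermonde_apply]
    rw [apolar_monomial, hV, altCoeff_apply, coeff_sum, Finset.mul_sum, Finset.mul_sum,
      Finset.mul_sum]
    refine Finset.sum_congr rfl fun w _ => ?_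
    rw [coeff_smul, coeff_monomial, coeff_monomial]
    by_cases hw : permExp w = b
    · have h1 : ∏ i, (b i).factorial = ∏ i : Fin n, (i : ℕ).factorial := by
        rw [← hw]
        exact Equiv.prod_comp w fun i : Fin n => (i : ℕ).factorial
      rw [if_pos hw, if_pos hw.symm, h1]
      simp only [zsmul_eq_mul]
      ring
    · rw [if_neg hw, if_neg (Ne.symm hw)]
      simp

/-- Polynomials with integer coefficients. -/
noncomputable def intPoly (n : ℕ) : Subring (Poly n) := (map (Int.castRingHom ℂ)).range

lemma partialD_mem_intPoly {f : Poly n} (hf : f ∈ intPoly n) (i : Fin n) :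
    partialD i f ∈ intPoly n := by
  obtain ⟨g, rfl⟩ := hf
  exact ⟨pderiv i g, pderiv_map.symm⟩

lemma iterPartial_mem_intPoly {k : ℕ} {f : Poly n} (hf : f ∈ intPoly n) (i : Fin k → Fin n)
    (e : Fin k → ℕ) : iterPartial i e f ∈ intPoly n := by
  have hpow : ∀ (j : Fin n) (m : ℕ) (g : Poly n), g ∈ intPoly n →
      (partialD j ^ m) g ∈ intPoly n := by
    intro j m
    induction m with
    | zero => exact fun g hg => hg
    | succ m ih =>
      intro g hg
      rw [pow_succ, Module.End.mul_apply]
      exact ih _ (partialD_mem_intPoly hg j)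
  induction k with
  | zero => simpa [iterPartial] using hf
  | succ k ih =>
    rw [iterPartial_succ]
    exact hpow _ _ _ (ih _ _)

/-- Positive definiteness of the apolar pairing on polynomials with integer coefficients. -/
lemma exists_apolar_self_eq {f : Poly n} (hf : f ∈ intPoly n) :
    ∃ r : ℝ, apolar n f f = r ∧ 0 ≤ r ∧ (r = 0 → f = 0) := by
  obtain ⟨g, rfl⟩ := hf
  set f : Poly n := map (Int.castRingHom ℂ) g with hfdef
  have hc : ∀ a, coeff a f = (((coeff a g : ℤ) : ℝ) : ℂ) := by
    intro a
    rw [hfdef, coeff_map]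
    simp
  refine ⟨∑ a ∈ f.support, ((∏ i, (a i).factorial : ℕ) : ℝ) * ((coeff a g : ℤ) : ℝ) ^ 2, ?_, ?_, ?_⟩
  · have h1 : ∀ h, apolar n f h = ∑ a ∈ f.support, apolar n (monomial a (coeff a f)) h := by
      intro h
      conv_lhs => rw [f.as_sum]
      rw [map_sum, LinearMap.sum_apply]
    rw [h1, Complex.ofReal_sum]
    refine Finset.sum_congr rfl fun a _ => ?_
    rw [apolar_monomial, hc]
    push_cast
    ring
  · exact Finset.sum_nonneg fun a _ => by positivity
  · intro h0
    rw [Finset.sum_eq_zero_iff_of_nonneg fun a _ => by positivity] at h0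
    ext a
    rw [coeff_zero]
    by_contra hne
    have h2 := h0 a (mem_support_iff.2 hne)
    have h3 : ((∏ i, (a i).factorial : ℕ) : ℝ) ≠ 0 := by
      exact_mod_cast (Finset.prod_pos fun i _ => (a i).factorial_pos).ne'
    have h4 : ((coeff a g : ℤ) : ℝ) = 0 := 
      pow_eq_zero_iff two_ne_zero |>.1 ((mul_eq_zero.1 h2).resolve_left h3)
    exact hne (by rw [hc, h4, Complex.ofReal_zero])

end Apolar

/-! ### Nonvanishing of `d_1 ⋯ d_k Δ` -/

section Sharpness

open MvPolynomial

variable {n : ℕ}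

/-- The antisymmetrization `∑_π sgn(π) ∂_{i_{π(0)}} ∂_{i_{π(1)}} ^ 2 ⋯ h`, which for distinct
indices is the coefficient of `dx_{i_0} ∧ ⋯ ∧ dx_{i_{k-1}}` in `d_1 ⋯ d_k h`. -/
noncomputable def altPartial {k : ℕ} (i : Fin k → Fin n) (h : Poly n) : Poly n :=
  ∑ π : Equiv.Perm (Fin k),
    (Equiv.Perm.sign π : ℤ) • iterPartial (i ∘ π) (fun a => (a : ℕ) + 1) h

lemma altPartial_comp {k : ℕ} (i : Fin k → Fin n) (ρ : Equiv.Perm (Fin k)) (h : Poly n) :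
    altPartial (i ∘ ρ) h = (Equiv.Perm.sign ρ : ℤ) • altPartial i h := by
  rw [altPartial, altPartial, Finset.smul_sum, ← Equiv.sum_comp (Equiv.mulLeft ρ)
    fun π : Equiv.Perm (Fin k) => (Equiv.Perm.sign ρ : ℤ) • (Equiv.Perm.sign π : ℤ) •
      iterPartial (i ∘ π) (fun a => (a : ℕ) + 1) h]
  refine Finset.sum_congr rfl fun π _ => ?_
  rw [smul_smul]
  congr 1
  simp only [Equiv.coe_mulLeft, map_mul, Units.val_mul]
  rw [← mul_assoc, Int.units_coe_mul_self, one_mul]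

lemma altPartial_mem_intPoly {k : ℕ} (i : Fin k → Fin n) {h : Poly n} (hh : h ∈ intPoly n) :
    altPartial i h ∈ intPoly n :=
  sum_mem fun _ _ => zsmul_mem (iterPartial_mem_intPoly hh _ _) _

/-- The determinant `det (x_{i_a} ^ (b + 1))` is adjoint to the operator `altPartial i`. -/
lemma apolar_mul_det {k : ℕ} (i : Fin k → Fin n) (f h : Poly n) :
    apolar n (f * (Matrix.of fun a b : Fin k => (X (i a) : Poly n) ^ ((b : ℕ) + 1)).det) h =
      apolar n f (altPartial i h) := by
  rw [Matrix.det_apply, Finset.mul_sum, altPartial, map_sum, map_sum, LinearMap.sum_apply]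
  refine Finset.sum_congr rfl fun π _ => ?_
  rw [Units.smul_def, mul_smul_comm, map_zsmul, map_zsmul, LinearMap.smul_apply,
    ← apolar_mul_prod_X_pow]
  rfl

lemma liftAlternating_wedgeSeq {k : ℕ} (i : Fin k → Fin n) :
    ExteriorAlgebra.liftAlternating (detForm n) (wedgeSeq i) =
      (Matrix.of fun a b : Fin k => (X (i a) : Poly n) ^ ((b : ℕ) + 1)).det := by
  rw [wedgeSeq, ExteriorAlgebra.liftAlternating_apply_ιMulti, detForm_apply]
  congr 1
  ext1 a b
  simp [Pi.single_apply]

/-- The sum of squares to which the pairing of `d_1 ⋯ d_k h` with itself amounts. -/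
lemma factorial_mul_sum_apolar {k : ℕ} (h : Poly n) :
    (k.factorial : ℂ) * ∑ i : Fin k → Fin n,
        apolar n (iterPartial i (fun a => (a : ℕ) + 1) h) (altPartial i h) =
      ∑ i : Fin k → Fin n, apolar n (altPartial i h) (altPartial i h) := by
  have h1 : ∀ i : Fin k → Fin n, apolar n (altPartial i h) (altPartial i h) =
      ∑ π : Equiv.Perm (Fin k),
        apolar n (iterPartial (i ∘ π) (fun a => (a : ℕ) + 1) h) (altPartial (i ∘ π) h) := by
    intro i
    have h0 : ∀ g, apolar n (altPartial i h) g = ∑ π : Equiv.Perm (Fin k),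
        (Equiv.Perm.sign π : ℤ) • apolar n (iterPartial (i ∘ π) (fun a => (a : ℕ) + 1) h) g := by
      intro g
      rw [altPartial, map_sum, LinearMap.sum_apply]
      exact Finset.sum_congr rfl fun π _ => by rw [map_zsmul, LinearMap.smul_apply]
    rw [h0]
    exact Finset.sum_congr rfl fun π _ => by rw [altPartial_comp, map_zsmul]
  rw [Finset.sum_congr rfl fun i _ => h1 i, Finset.sum_comm]
  have h2 : ∀ π : Equiv.Perm (Fin k), ∑ i : Fin k → Fin n,
      apolar n (iterPartial (i ∘ π) (fun a => (a : ℕ) + 1) h) (altPartial (i ∘ π) h) =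
      ∑ i : Fin k → Fin n,
        apolar n (iterPartial i (fun a => (a : ℕ) + 1) h) (altPartial i h) := fun π =>
    (Equiv.arrowCongr π.symm (Equiv.refl (Fin n))).sum_comp fun i : Fin k → Fin n =>
      apolar n (iterPartial i (fun a => (a : ℕ) + 1) h) (altPartial i h)
  rw [Finset.sum_congr rfl fun π _ => h2 π, Finset.sum_const, Finset.card_univ, Fintype.card_perm,
    Fintype.card_fin, nsmul_eq_mul]

lemma exists_vandermonde_eq (n : ℕ) : ∃ ε : ℂ, ε ≠ 0 ∧
    vandermonde n = ε • ((Matrix.vandermonde (X : Fin n → Poly n)).det ⊗ₜ[ℂ] (1 : Grass n)) := by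
  refine ⟨∏ i : Fin n, ∏ _j ∈ Finset.Ioi i, (-1), ?_, ?_⟩
  · exact Finset.prod_ne_zero_iff.2 fun i _ => Finset.prod_ne_zero_iff.2 fun j _ => by simp
  · rw [vandermonde, Matrix.det_vandermonde, TensorProduct.smul_tmul', MvPolynomial.smul_eq_C_mul,
      map_prod, ← Finset.prod_mul_distrib]
    congr 1
    refine Finset.prod_congr rfl fun i _ => ?_
    rw [map_prod, ← Finset.prod_mul_distrib]
    refine Finset.prod_congr rfl fun j _ => ?_
    rw [map_neg, C_1]
    ring

lemma dVandermonde_eq (n k : ℕ) : dVandermonde n k =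
    (List.ofFn fun a : Fin k => dOp n ((a : ℕ) + 1)).prod (vandermonde n) := by
  rw [dVandermonde]
  congr 2
  apply List.ext_getElem <;> simp

lemma det_vandermonde_X_mem_intPoly (n : ℕ) :
    (Matrix.vandermonde (X : Fin n → Poly n)).det ∈ intPoly n := by
  rw [Matrix.det_vandermonde]
  have hX : ∀ j : Fin n, (X j : Poly n) ∈ intPoly n := fun j => ⟨X j, map_X _ _⟩
  exact prod_mem fun i _ => prod_mem fun j _ => sub_mem (hX j) (hX i)

lemma isHomogeneous_det_vandermonde_X (n : ℕ) :
    (Matrix.vandermonde (X : Fin n → Poly n)).det.IsHomogeneous (n.choose 2) := by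
  rw [Matrix.det_apply]
  refine IsHomogeneous.sum _ _ _ fun σ _ => ?_
  have h1 := IsHomogeneous.prod Finset.univ
    (fun i : Fin n => (X (σ i) : Poly n) ^ (i : ℕ)) (fun i => (i : ℕ))
    fun i _ => isHomogeneous_X_pow _ _
  rw [Fin.sum_univ_eq_sum_range (fun i => i) n, Finset.sum_range_id, ← Nat.choose_two_right] at h1
  rw [Units.smul_def]
  exact (homogeneousSubmodule (Fin n) ℂ _).toAddSubgroup.zsmul_mem h1 _

lemma dVandermonde_mem_homForms {l k : ℕ} (hl : l = n.choose 2 - (k + 1).choose 2) :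
    dVandermonde n k ∈ homForms n l k := by
  obtain ⟨ε, -, hε⟩ := exists_vandermonde_eq n
  rw [dVandermonde_eq, hε, map_smul, prod_dOp_apply]
  refine Submodule.smul_mem _ _ (Submodule.sum_mem _ fun i _ => tmul_wedgeSeq_mem_homForms ?_ i)
  have h := isHomogeneous_iterPartial (isHomogeneous_det_vandermonde_X n) i
    fun a : Fin k => (a : ℕ) + 1
  convert h using 1
  rw [hl, Fin.sum_univ_eq_sum_range (fun i => i + 1) k, Nat.choose_two_right (k + 1),
    ← Finset.sum_range_id, Finset.sum_range_succ']
  simp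

/-- `d_1 ⋯ d_k Δ` is not in the ideal as soon as one of its coefficients is nonzero: the functional
`altCoeff ∘ formDet`, which vanishes on the ideal, takes it to the sum of the squared norms of the
coefficients, up to a nonzero factor. -/
lemma dVandermonde_notMem_of_altPartial_ne_zero {k : ℕ} {i₀ : Fin k → Fin n}
    (hne : altPartial i₀ (Matrix.vandermonde (X : Fin n → Poly n)).det ≠ 0) :
    dVandermonde n k ∉ invIdeal n := by
  intro hmem
  set V := (Matrix.vandermonde (X : Fin n → Poly n)).det with hV
  obtain ⟨ε, hε0, hε⟩ := exists_vandermonde_eq n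
  have h1 : altCoeff n ℂ (formDet n (dVandermonde n k)) = 0 := by
    simpa using mem_altAnn.1 (formDet_mem_altAnn hmem) 1
  rw [dVandermonde_eq, hε, map_smul, prod_dOp_apply, map_smul, map_smul, smul_eq_mul,
    mul_eq_zero, or_iff_right hε0, map_sum] at h1
  have h2 : ∑ i : Fin k → Fin n,
      apolar n (iterPartial i (fun a => (a : ℕ) + 1) V) (altPartial i V) = 0 := by
    have h3 := congrArg (fun z => ((∏ i : Fin n, (i : ℕ).factorial : ℕ) : ℂ) * z) h1
    simp only [mul_zero] at h3
    rw [← apolar_det_vandermonde, map_sum, LinearMap.sum_apply] at h3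
    rw [← h3]
    refine Finset.sum_congr rfl fun i _ => ?_
    rw [formDet_tmul, liftAlternating_wedgeSeq, apolar_mul_det]
  have h4 := factorial_mul_sum_apolar (k := k) V
  rw [h2, mul_zero] at h4
  choose r hr hr0 hrz using fun i : Fin k → Fin n =>
    exists_apolar_self_eq (altPartial_mem_intPoly i (det_vandermonde_X_mem_intPoly n))
  have h5 : ∑ i, r i = 0 := by
    rw [Finset.sum_congr rfl fun i _ => hr i, ← Complex.ofReal_sum] at h4
    exact_mod_cast h4.symm
  rw [Finset.sum_eq_zero_iff_of_nonneg fun i _ => hr0 i] at h5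
  exact hne (hrz i₀ (h5 i₀ (Finset.mem_univ _)))

theorem dVandermonde_notMem_invIdeal {k : ℕ} (hk : (k + 1).choose 2 ≤ n.choose 2) :
    dVandermonde n k ∉ invIdeal n := by
  have hadj : ∀ (hkn : k ≤ n) (f : Poly n), altCoeff n ℂ (powDet hkn * f) ≠ 0 →
      altPartial (Fin.castLE hkn) (Matrix.vandermonde (X : Fin n → Poly n)).det ≠ 0 := by
    intro hkn f hf h0
    have h1 := apolar_mul_det (Fin.castLE hkn) f (Matrix.vandermonde (X : Fin n → Poly n)).det
    rw [h0, map_zero, apolar_det_vandermonde, mul_eq_zero] at h1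
    rcases h1 with h1 | h1
    · have h3 : 0 < ∏ i : Fin n, (i : ℕ).factorial :=
        Finset.prod_pos fun i _ => Nat.factorial_pos _
      exact h3.ne' (Nat.cast_eq_zero.1 h1)
    · exact hf (by rw [mul_comm]; exact h1)
  rcases lt_or_ge k n with hlt | hge
  · exact dVandermonde_notMem_of_altPartial_ne_zero
      (hadj hlt.le _ (altCoeff_powDet_mul_det_ne_zero ⟨k, hlt⟩))
  · -- only the case `n = k = 0` remains
    have hk0 : k = 0 := by
      by_contra h0
      have h1 : n.choose 2 ≤ k.choose 2 := Nat.choose_le_choose 2 hge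
      have h2 : (k + 1).choose 2 = k.choose 1 + k.choose 2 := Nat.choose_succ_succ k 1
      rw [Nat.choose_one_right] at h2
      omega
    subst hk0
    obtain rfl : n = 0 := by omega
    refine dVandermonde_notMem_of_altPartial_ne_zero (hadj le_rfl 1 ?_)
    rw [powDet, Matrix.det_isEmpty, mul_one, altCoeff_apply]
    simp [coeff_one, Subsingleton.elim _ (0 : Fin 0 →₀ ℕ)]

end Sharpness

end PolyForms

theorem theorem14 (n : ℕ) :
    (∀ (l k : ℕ) (ω : PolyForms.Omega n), ω ∈ PolyForms.homForms n l k →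
      (l : ℤ) > (n.choose 2 : ℤ) - ((k + 1).choose 2 : ℤ) → ω ∈ PolyForms.invIdeal n) ∧
    (∀ l k : ℕ, (l : ℤ) = (n.choose 2 : ℤ) - ((k + 1).choose 2 : ℤ) →
      (PolyForms.homForms n l k).map (PolyForms.toQuot n).toLinearMap ≠ ⊥ ∧
      PolyForms.dVandermonde n k ∈ PolyForms.homForms n l k ∧
      PolyForms.toQuot n (PolyForms.dVandermonde n k) ≠ 0) := by
  refine ⟨fun l k ω hω hl => PolyForms.mem_invIdeal_of_mem_homForms hω hl, fun l k hl => ?_⟩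
  have hmem : PolyForms.dVandermonde n k ∈ PolyForms.homForms n l k :=
    PolyForms.dVandermonde_mem_homForms (by omega)
  have hne : PolyForms.toQuot n (PolyForms.dVandermonde n k) ≠ 0 := fun h =>
    PolyForms.dVandermonde_notMem_invIdeal (by omega)
      ((TwoSidedIdeal.mem_iff _ _).2 ((RingCon.eq _).1 h))
  refine ⟨fun hbot => hne ?_, hmem, hne⟩
  exact (Submodule.eq_bot_iff _).1 hbot _ ⟨_, hmem, rfl⟩
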